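/- Let $k\ge 1$ and $n\ge 0$ be integers with $n\le k$. \textbf{The fused permutations algebra $H_{k,n}$.} A fused permutation is a sequence $(S_1,\dots,S_{n+1})$ of multisets of elements of $\{1,\dots,n+1\}$ with $|S_1|=k$ and $|S_a|=1$ for $a\ge 2$, in which $1$ appears $k$ times in total and each of $2,\dots,n+1$ appears once. It is seen as a diagram on two lines of $n+1$ points, the elements of $S_a$ being the bottom points joined to the top point $a$. $H_{k,n}$ is the $\mathbb{C}$-algebra with basis the fused permutations, where $d\cdot d'$ is obtained by placing $d$ above $d'$ and taking the average over the $k!$ ways of connecting the $k$ edges arriving at the first middle point to the $k$ edges leaving it. For $1\le i\le n-1$ let $\sigma_i$ be the diagram crossing the edges at the points $i+1$ and $i+2$ (all other edges vertical), and, for $n\ge1$, let $\sigma_0=(\{\{1^{k-1},2\}\},\{1\},\{3\},\dots,\{n+1\})$ and $t=1+k\sigma_0$. \textbf{The Hecke algebra.} For $\kappa=(\kappa_1,\kappa_2)\in\mathbb{C}^2$, $\hat{\mathcal H}_n^{\kappa}$ is the unital associative $\mathbb{C}$-algebra with generators $x_1,\dots,x_n,s_1,\dots,s_{n-1}$ and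 relations $(x_1-\kappa_1)(x_1-\kappa_2)=0$, $x_rs_l=s_lx_r$ for $r\ne l,l+1$, $x_rx_u=x_ux_r$, $x_{r+1}=s_rx_rs_r+s_r$, $s_i^2=1$, $s_is_j=s_js_i$ for $|i-j|>1$, $s_is_{i+1}s_i=s_{i+1}s_is_{i+1}$ (so $\hat{\mathcal H}_0^\kappa=\mathbb{C}$). The algebra $\mathcal A_n^{\kappa}$ is its quotient by the relation \[(x_1s_1)^2=\kappa_1(1+\kappa_1)(s_1-1)+\kappa_1(s_1x_1s_1-s_1x_1)+(1+\kappa_1)(x_1-x_1s_1)+x_1s_1x_1\] if $n\ge2$, and $\mathcal A_n^\kappa=\hat{\mathcal H}_n^\kappa$ if $n=0,1$. \textbf{The idempotent.} Let $\kappa=(0,k+1)$. The content of a box in component $l$, row $r$, column $c$ of a bipartition is $\kappa_l+c-r$. Let $\mathcal C_2$ be the set of contents of all boxes of bipartitions of $2$. In $\hat{\mathcal H}_2^{(0,k+1)}$ put \[F_2^{(-1,k+1)}=\prod_{c\in\mathcal C_2,\,c\ne k+1}\frac{x_1-c}{k+1-c}\ \prod_{c\in\mathcal C_2,\,c\ne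 k}\frac{x_2-c}{k-c}\] (the element attached to the standard tableau of shape $(\emptyset,(1,1))$). For $n\ge2$ it is regarded as an element of $\hat{\mathcal H}_n^{(0,k+1)}$ through the morphism sending each generator to the generator with the same name. \textbf{Signed permutations.} $B_n$ is the group of permutations $\omega$ of $\{\pm1,\dots,\pm n\}$ with $\omega(-i)=-\omega(i)$, written as words $\omega(1)\cdots\omega(n)$, a negative number $-m$ being written $\bar m$; $\tau_0$ exchanges $\pm1$, and $\tau_i$ exchanges $i,i+1$ and $-i,-(i+1)$. Each $\omega\in B_n$ has a unique normal form $\omega=w_0w_1\cdots w_{n-1}$ in which $w_j$ is a (possibly empty) prefix of $\tau_j\tau_{j-1}\cdots\tau_1\tau_0\tau_1\cdots\tau_j$; let $s_\omega\in\hat{\mathcal H}_n^\kappa$ be obtained from this expression by replacing each $\tau_i$, $i\ge1$, by $s_i$ and $\tau_0$ by $x_1$. $B_n(\bar1\bar2)$ is the set of $\omega\in B_n$ whose barred numbers, read from left to right in the word, are in decreasing order (bars ignored). \textbf{Theorem.} There is a unital algebra morphism $\varphi:\hat{\mathcal H}_n^{(0,k+1)}\to H_{k,n}$ with $\varphi(s_i)=\sigma_i$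 for $1\le i\le n-1$ and (if $n\ge1$) $\varphi(x_1)=t$. It is surjective, and: (1) $\varphi$ induces an isomorphism of algebras $\mathcal A_n^{(0,k+1)}\cong H_{k,n}$; (2) $\ker\varphi$ is the two-sided ideal generated by $F_2^{(-1,k+1)}$ if $n\ge2$, and $\ker\varphi=0$ if $n\le1$; (3) the elements $\varphi(s_\omega)$, $\omega\in B_n(\bar1\bar2)$, form a basis of $H_{k,n}$. -/

import Mathlib

/-! ### Fused permutations

The points `1, …, n+1` of each of the two lines are indexed by `Fin (n+1)`, so that the thick point
(the one carrying `k` edges) is `0 : Fin (n+1)`. -/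

/-- A fused permutation: a sequence `S 0, …, S n` of multisets of points, `S a` consisting of the
bottom points reached from the top point `a`. -/
@[ext]
structure FusedPerm (k n : ℕ) where
  S : Fin (n + 1) → Multiset (Fin (n + 1))
  card_zero : (S 0).card = k
  card_succ : ∀ i : Fin n, (S i.succ).card = 1
  count_zero : ∑ a, (S a).count 0 = k
  count_succ : ∀ j : Fin n, ∑ a, (S a).count j.succ = 1

/-- The gluing map from `k + n` dots to `n + 1` points: the first `k` dots are glued together. -/
def glue (k n : ℕ) : Fin k ⊕ Fin n → Fin (n + 1) := Sum.elim (fun _ => 0) Fin.succ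

/-- The number of edges at a point. -/
def pointWeight (k n : ℕ) : Fin (n + 1) → ℕ := Fin.cons k (fun _ => 1)

theorem card_glue_fiber (k n : ℕ) (c : Fin (n + 1)) :
    Fintype.card {x : Fin k ⊕ Fin n // glue k n x = c} = pointWeight k n c := by
  rw [Fintype.card_subtype]
  refine Fin.cases ?_ (fun i => ?_) c
  · have : (Finset.univ.filter fun x : Fin k ⊕ Fin n => glue k n x = 0)
        = Finset.univ.map ⟨Sum.inl, Sum.inl_injective⟩ := by
      ext x
      rw [Finset.mem_filter]
      rcases x with x | x <;> simp [glue]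
    rw [this]; simp [pointWeight]
  · have : (Finset.univ.filter fun x : Fin k ⊕ Fin n => glue k n x = i.succ)
        = {Sum.inr i} := by
      ext x
      rw [Finset.mem_filter]
      rcases x with x | x <;> simp [glue, (Fin.succ_ne_zero i).symm]
    rw [this]; simp [pointWeight]

/-- The multiset of bottom points reached from the top point `a`, in the diagram of the permutation
`w` of the `k + n` dots (bottom dot `x` is connected to top dot `w x`) after gluing. -/
def fuseAt {k n : ℕ} (w : Equiv.Perm (Fin k ⊕ Fin n)) (a : Fin (n + 1)) :
    Multiset (Fin (n + 1)) :=
  (Finset.univ.filter fun x => glue k n (w x) = a).val.map (glue k n)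

theorem card_fuseAt {k n : ℕ} (w : Equiv.Perm (Fin k ⊕ Fin n)) (a : Fin (n + 1)) :
    (fuseAt w a).card = pointWeight k n a := by
  rw [fuseAt, Multiset.card_map, ← card_glue_fiber, Finset.card_val, ← Fintype.card_subtype]
  exact Fintype.card_congr (w.subtypeEquiv fun _ => Iff.rfl)

theorem count_fuseAt {k n : ℕ} (w : Equiv.Perm (Fin k ⊕ Fin n)) (a b : Fin (n + 1)) :
    (fuseAt w a).count b
      = Fintype.card {x : Fin k ⊕ Fin n // (glue k n (w x), glue k n x) = (a, b)} := by
  rw [fuseAt, Multiset.count_map, Fintype.card_subtype, ← Finset.filter_val, Finset.card_val,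
    Finset.filter_filter]
  congr 1
  ext x
  simp [eq_comm]

theorem sum_count_fuseAt {k n : ℕ} (w : Equiv.Perm (Fin k ⊕ Fin n)) (b : Fin (n + 1)) :
    ∑ a, (fuseAt w a).count b = pointWeight k n b := by
  simp_rw [count_fuseAt, Fintype.card_subtype, Prod.mk.injEq]
  rw [← card_glue_fiber, Fintype.card_subtype,
    Finset.card_eq_sum_card_fiberwise (f := fun x => glue k n (w x)) (t := Finset.univ)
      (fun _ _ => Finset.mem_coe.2 (Finset.mem_univ _))]
  refine Finset.sum_congr rfl fun a _ => ?_
  rw [Finset.filter_filter]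
  congr 1
  ext x
  simp [and_comm]

/-- The fused permutation `[w]` of a permutation `w` of `k + n` dots: the diagram of `w`, with the
`k` first dots of each of the two rows glued together. -/
def fuse {k n : ℕ} (w : Equiv.Perm (Fin k ⊕ Fin n)) : FusedPerm k n where
  S := fuseAt w
  card_zero := card_fuseAt w 0
  card_succ i := card_fuseAt w i.succ
  count_zero := sum_count_fuseAt w 0
  count_succ j := sum_count_fuseAt w j.succ

theorem exists_equiv_of_card_fiber {X Y C : Type*} [Fintype X] [Fintype Y] [DecidableEq C]
    (f : X → C) (g : Y → C)
    (h : ∀ c, Fintype.card {x // f x = c} = Fintype.card {y // g y = c}) :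
    ∃ e : X ≃ Y, ∀ x, g (e x) = f x :=
  ⟨Equiv.ofFiberEquiv fun c => Fintype.equivOfCardEq (h c), Equiv.ofFiberEquiv_map _⟩

/-- Every fused permutation is obtained by gluing: its edges can be numbered. -/
theorem fuse_surjective (k n : ℕ) : Function.Surjective (fuse (k := k) (n := n)) := by
  intro d
  let M : Fin (n + 1) → Fin (n + 1) → ℕ := fun a b => (d.S a).count b
  let E := Σ a, Σ b, Fin (M a b)
  have hrow : ∀ a, ∑ b, M a b = pointWeight k n a := by
    intro a
    have : ∑ b, M a b = (d.S a).card := Multiset.sum_count_eq_card (fun _ _ => Finset.mem_univ _)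
    rw [this]
    exact Fin.cases d.card_zero d.card_succ a
  have hcol : ∀ b, ∑ a, M a b = pointWeight k n b := fun b =>
    Fin.cases (motive := fun b => ∑ a, M a b = pointWeight k n b) d.count_zero d.count_succ b
  have hE : ∀ (p : Fin (n + 1) → Fin (n + 1) → Prop) [∀ a b, Decidable (p a b)],
      Fintype.card {e : E // p e.1 e.2.1} = ∑ a, ∑ b, if p a b then M a b else 0 := by
    intro p _
    rw [Fintype.card_subtype, Finset.card_filter, Fintype.sum_sigma]
    refine Finset.sum_congr rfl fun a _ => ?_
    rw [Fintype.sum_sigma]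
    refine Finset.sum_congr rfl fun b _ => ?_
    by_cases hp : p a b <;> simp [hp]
  obtain ⟨et, het⟩ := exists_equiv_of_card_fiber (fun e : E => e.1) (glue k n) (fun c => by
    rw [card_glue_fiber, hE fun a _ => a = c]
    rw [Finset.sum_eq_single c (by intro b _ hb; simp [hb]) (by simp)]
    simpa using hrow c)
  obtain ⟨eb, heb⟩ := exists_equiv_of_card_fiber (fun e : E => e.2.1) (glue k n) (fun c => by
    rw [card_glue_fiber, hE fun _ b => b = c]
    simpa using hcol c)
  refine ⟨eb.symm.trans et, FusedPerm.ext (funext fun a => Multiset.ext.2 fun b => ?_)⟩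
  change (fuseAt _ a).count b = M a b
  rw [count_fuseAt]
  have : Fintype.card {x : Fin k ⊕ Fin n //
      (glue k n ((eb.symm.trans et) x), glue k n x) = (a, b)}
      = Fintype.card {e : E // e.1 = a ∧ e.2.1 = b} := by
    refine Fintype.card_congr (eb.symm.subtypeEquiv fun x => ?_)
    rw [Equiv.trans_apply, het, ← heb, Equiv.apply_symm_apply, Prod.mk.injEq]
  rw [this, hE fun a' b' => a' = a ∧ b' = b]
  rw [Finset.sum_eq_single a (by intro c _ hc; simp [hc]) (by simp)]
  simp

/-- A permutation of the `k` edges at the thick point, acting on the `k + n` edges. -/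
def thick (k n : ℕ) (p : Equiv.Perm (Fin k)) : Equiv.Perm (Fin k ⊕ Fin n) :=
  Equiv.sumCongr p (Equiv.refl (Fin n))

theorem thick_mul (k n : ℕ) (p q : Equiv.Perm (Fin k)) :
    thick k n (p * q) = thick k n p * thick k n q := by
  ext x; rcases x with x | x <;> rfl

theorem glue_thick (k n : ℕ) (p : Equiv.Perm (Fin k)) (x : Fin k ⊕ Fin n) :
    glue k n (thick k n p x) = glue k n x := by
  rcases x with x | x <;> rfl

theorem exists_eq_thick {k n : ℕ} (w : Equiv.Perm (Fin k ⊕ Fin n))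
    (h : ∀ x, glue k n (w x) = glue k n x) : ∃ p, w = thick k n p := by
  have h1 : Set.MapsTo w (Set.range Sum.inl) (Set.range Sum.inl) := by
    rintro _ ⟨a, rfl⟩
    have := h (Sum.inl a)
    rcases hw : w (Sum.inl a) with b | b
    · exact ⟨b, rfl⟩
    · rw [hw] at this
      exact absurd this (Fin.succ_ne_zero b)
  obtain ⟨⟨p, q⟩, hpq⟩ := Equiv.Perm.mem_sumCongrHom_range_of_perm_mapsTo_inl h1
  refine ⟨p, ?_⟩
  rw [← hpq]
  ext x
  rcases x with x | x
  · rfl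
  · have := h (Sum.inr x)
    rw [← hpq] at this
    have h2 : q x = x := Fin.succ_injective n this
    change Sum.inr (q x) = Sum.inr x
    rw [h2]

theorem fuse_thick_mul {k n : ℕ} (p : Equiv.Perm (Fin k)) (w : Equiv.Perm (Fin k ⊕ Fin n)) :
    fuse (thick k n p * w) = fuse w := by
  refine FusedPerm.ext (funext fun a => ?_)
  change fuseAt _ a = fuseAt _ a
  simp only [fuseAt, Equiv.Perm.mul_apply, glue_thick]

theorem fuse_mul_thick {k n : ℕ} (p : Equiv.Perm (Fin k)) (w : Equiv.Perm (Fin k ⊕ Fin n)) :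
    fuse (w * thick k n p) = fuse w := by
  refine FusedPerm.ext (funext fun a => Multiset.ext.2 fun b => ?_)
  change (fuseAt _ a).count b = (fuseAt _ a).count b
  rw [count_fuseAt, count_fuseAt]
  refine Fintype.card_congr ((thick k n p).subtypeEquiv fun x => ?_)
  rw [glue_thick, Equiv.Perm.mul_apply]

/-- Two permutations with the same fused permutation differ by permutations of the edges at the
two thick points. -/
theorem exists_thick_of_fuse_eq {k n : ℕ} {w w' : Equiv.Perm (Fin k ⊕ Fin n)}
    (h : fuse w = fuse w') : ∃ p q, w = thick k n p * w' * thick k n q := by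
  obtain ⟨r, hr⟩ := exists_equiv_of_card_fiber
    (fun x => (glue k n (w x), glue k n x)) (fun x => (glue k n (w' x), glue k n x))
    (fun c => by
      rw [← count_fuseAt, ← count_fuseAt]
      exact congrArg (fun d : FusedPerm k n => (d.S c.1).count c.2) h)
  obtain ⟨q, hq⟩ := exists_eq_thick (k := k) (n := n) r fun x => (Prod.ext_iff.1 (hr x)).2
  obtain ⟨p, hp⟩ := exists_eq_thick (k := k) (n := n) (w * (w' * r)⁻¹) fun x => by
    obtain ⟨y, rfl⟩ := (w' * r).surjective x
    have := (Prod.ext_iff.1 (hr y)).1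
    rw [Equiv.Perm.mul_apply, ← Equiv.Perm.mul_apply (w' * r)⁻¹, inv_mul_cancel,
      Equiv.Perm.one_apply, Equiv.Perm.mul_apply]
    exact this.symm
  refine ⟨p, q, ?_⟩
  rw [← hp, ← hq]
  group

/-! ### The fused permutations algebra -/

/-- The complex vector space with basis the fused permutations; it carries the multiplication of
diagrams below. -/
def FusedAlg (k n : ℕ) : Type := FusedPerm k n →₀ ℂ

noncomputable section

namespace FusedAlg

variable {k n : ℕ}

instance : AddCommGroup (FusedAlg k n) := inferInstanceAs (AddCommGroup (FusedPerm k n →₀ ℂ))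

instance : Module ℂ (FusedAlg k n) := inferInstanceAs (Module ℂ (FusedPerm k n →₀ ℂ))

/-- The basis of diagrams. -/
def diagramBasis (k n : ℕ) : Module.Basis (FusedPerm k n) ℂ (FusedAlg k n) :=
  Module.Basis.ofRepr (LinearEquiv.refl ℂ (FusedPerm k n →₀ ℂ))

/-- The basis element of a fused permutation. -/
def ofDiagram (d : FusedPerm k n) : FusedAlg k n := diagramBasis k n d

/-- A numbering of the edges of a diagram, i.e. a permutation of `k + n` dots with this diagram
after gluing. Products do not depend on the choice, see `ofDiagram_fuse_mul`. -/
def lift (d : FusedPerm k n) : Equiv.Perm (Fin k ⊕ Fin n) :=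
  Function.surjInv (fuse_surjective k n) d

theorem fuse_lift (d : FusedPerm k n) : fuse (lift d) = d :=
  Function.surjInv_eq (fuse_surjective k n) d

/-- The product of two diagrams, `d` above `d'`: the average of the `k!` diagrams obtained by
connecting in all possible ways the `k` edges arriving at the thick middle point with the `k` edges
leaving it. -/
def diagramMul (d d' : FusedPerm k n) : FusedAlg k n :=
  (k.factorial : ℂ)⁻¹ • ∑ p : Equiv.Perm (Fin k), ofDiagram (fuse (lift d * thick k n p * lift d'))

/-- The bilinear extension of the product of diagrams. -/
def mulBilin (k n : ℕ) : FusedAlg k n →ₗ[ℂ] FusedAlg k n →ₗ[ℂ] FusedAlg k n :=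
  (diagramBasis k n).constr ℂ fun d => (diagramBasis k n).constr ℂ fun d' => diagramMul d d'

instance : Mul (FusedAlg k n) := ⟨fun x y => mulBilin k n x y⟩

instance : One (FusedAlg k n) := ⟨ofDiagram (fuse 1)⟩

theorem mul_def (x y : FusedAlg k n) : x * y = mulBilin k n x y := rfl

theorem one_def : (1 : FusedAlg k n) = ofDiagram (fuse 1) := rfl

theorem ofDiagram_mul (d d' : FusedPerm k n) :
    ofDiagram d * ofDiagram d' = diagramMul d d' := by
  rw [mul_def, mulBilin, ofDiagram, ofDiagram, Module.Basis.constr_basis,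
    Module.Basis.constr_basis]

theorem ofDiagram_fuse_mul (w w' : Equiv.Perm (Fin k ⊕ Fin n)) :
    ofDiagram (fuse w) * ofDiagram (fuse w')
      = (k.factorial : ℂ)⁻¹ • ∑ p, ofDiagram (fuse (w * thick k n p * w')) := by
  rw [ofDiagram_mul, diagramMul]
  obtain ⟨a, b, hab⟩ := exists_thick_of_fuse_eq (fuse_lift (fuse w))
  obtain ⟨c, d, hcd⟩ := exists_thick_of_fuse_eq (fuse_lift (fuse w'))
  rw [hab, hcd]
  congr 1
  refine Fintype.sum_equiv ((Equiv.mulLeft b).trans (Equiv.mulRight c)) _ _ fun p => ?_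
  rw [show thick k n a * w * thick k n b * thick k n p * (thick k n c * w' * thick k n d)
      = thick k n a * ((w * (thick k n b * thick k n p * thick k n c) * w') * thick k n d) by
    simp only [mul_assoc]]
  rw [fuse_thick_mul, fuse_mul_thick, ← thick_mul, ← thick_mul]
  rfl

theorem add_mul' (x y z : FusedAlg k n) : (x + y) * z = x * z + y * z := by
  simp only [mul_def, map_add, LinearMap.add_apply]

theorem mul_add' (x y z : FusedAlg k n) : x * (y + z) = x * y + x * z := by
  simp only [mul_def, map_add]

theorem smul_mul' (c : ℂ) (x y : FusedAlg k n) : c • x * y = c • (x * y) := by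
  simp only [mul_def, map_smul, LinearMap.smul_apply]

theorem mul_smul' (c : ℂ) (x y : FusedAlg k n) : x * c • y = c • (x * y) := by
  simp only [mul_def, map_smul]

theorem zero_mul' (x : FusedAlg k n) : 0 * x = 0 := by
  simp only [mul_def, map_zero, LinearMap.zero_apply]

theorem mul_zero' (x : FusedAlg k n) : x * 0 = 0 := by
  simp only [mul_def, map_zero]

theorem sum_mul' {ι : Type*} (s : Finset ι) (f : ι → FusedAlg k n) (x : FusedAlg k n) :
    (∑ i ∈ s, f i) * x = ∑ i ∈ s, f i * x := by
  simp only [mul_def, map_sum, LinearMap.sum_apply]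

theorem mul_sum' {ι : Type*} (s : Finset ι) (f : ι → FusedAlg k n) (x : FusedAlg k n) :
    x * (∑ i ∈ s, f i) = ∑ i ∈ s, x * f i := by
  simp only [mul_def, map_sum]

theorem induction (P : FusedAlg k n → Prop) (x : FusedAlg k n) (h0 : P 0)
    (hadd : ∀ x y, P x → P y → P (x + y))
    (hof : ∀ (c : ℂ) (w : Equiv.Perm (Fin k ⊕ Fin n)), P (c • ofDiagram (fuse w))) : P x := by
  rw [← (diagramBasis k n).linearCombination_repr x, Finsupp.linearCombination_apply]
  refine Finset.sum_induction _ P hadd h0 fun d _ => ?_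
  have := hof ((diagramBasis k n).repr x d) (lift d)
  rwa [fuse_lift] at this

theorem factorial_inv_smul_sum (x : FusedAlg k n) :
    (k.factorial : ℂ)⁻¹ • ∑ _p : Equiv.Perm (Fin k), x = x := by
  rw [Finset.sum_const, Finset.card_univ, Fintype.card_perm, Fintype.card_fin,
    ← Nat.cast_smul_eq_nsmul ℂ, smul_smul,
    inv_mul_cancel₀ (Nat.cast_ne_zero.2 (Nat.factorial_ne_zero k)), one_smul]

theorem one_mul' (x : FusedAlg k n) : 1 * x = x := by
  refine induction (fun x => 1 * x = x) x (mul_zero' 1) (fun x y hx hy => by rw [mul_add', hx, hy])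
    fun c w => ?_
  rw [mul_smul', one_def, ofDiagram_fuse_mul]
  simp only [one_mul, fuse_thick_mul, factorial_inv_smul_sum]

theorem mul_one' (x : FusedAlg k n) : x * 1 = x := by
  refine induction (fun x => x * 1 = x) x (zero_mul' 1) (fun x y hx hy => by rw [add_mul', hx, hy])
    fun c w => ?_
  rw [smul_mul', one_def, ofDiagram_fuse_mul]
  simp only [mul_one, fuse_mul_thick, factorial_inv_smul_sum]

theorem mul_assoc' (x y z : FusedAlg k n) : x * y * z = x * (y * z) := by
  refine induction (fun x => x * y * z = x * (y * z)) x (by simp only [zero_mul'])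
    (fun x x' hx hx' => by simp only [add_mul', hx, hx']) fun c₁ w₁ => ?_
  refine induction (fun y => _ * y * z = _ * (y * z)) y (by simp only [zero_mul', mul_zero'])
    (fun y y' hy hy' => by simp only [add_mul', mul_add', hy, hy']) fun c₂ w₂ => ?_
  refine induction (fun z => _ * z = _ * (_ * z)) z (by simp only [mul_zero'])
    (fun z z' hz hz' => by simp only [mul_add', hz, hz']) fun c₃ w₃ => ?_
  simp only [smul_mul', mul_smul', ofDiagram_fuse_mul, sum_mul', mul_sum', ← Finset.smul_sum]
  rw [Finset.sum_comm]
  simp only [mul_assoc]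
  rw [smul_comm c₁ (k.factorial : ℂ)⁻¹]

instance : Ring (FusedAlg k n) :=
  { (inferInstance : AddCommGroup (FusedAlg k n)), (inferInstance : Mul (FusedAlg k n)),
    (inferInstance : One (FusedAlg k n)) with
    left_distrib := mul_add'
    right_distrib := add_mul'
    zero_mul := zero_mul'
    mul_zero := mul_zero'
    mul_assoc := mul_assoc'
    one_mul := one_mul'
    mul_one := mul_one' }

instance : Algebra ℂ (FusedAlg k n) := Algebra.ofModule smul_mul' mul_smul'

/-- `σ_{i+1}`: the diagram that crosses the edges at the points `i+1` and `i+2` among the `n` points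
other than the thick one. -/
def sigma (k n : ℕ) (i : Fin (n - 1)) : FusedAlg k n :=
  ofDiagram (fuse (Equiv.swap (Sum.inr ⟨i, by omega⟩) (Sum.inr ⟨i + 1, by omega⟩)))

/-- `σ₀`: the diagram that crosses one edge at the thick point with the edge at the first of the
other points. -/
def sigmaZero (k n : ℕ) (hk : 0 < k) (hn : 0 < n) : FusedAlg k n :=
  ofDiagram (fuse (Equiv.swap (Sum.inl ⟨k - 1, by omega⟩) (Sum.inr ⟨0, hn⟩)))

/-- `t = 1 + k σ₀`. -/
def t (k n : ℕ) (hk : 0 < k) (hn : 0 < n) : FusedAlg k n := 1 + (k : ℂ) • sigmaZero k n hk hn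

end FusedAlg

/-! ### The cyclotomic degenerate affine Hecke algebra -/

/-- The generators: `x r` is `x_{r+1}` and `s i` is `s_{i+1}`. -/
inductive HeckeGen (n : ℕ) : Type
  | x : Fin n → HeckeGen n
  | s : Fin (n - 1) → HeckeGen n

/-- The generator `x_{r+1}` in the free algebra. -/
def freeX {n : ℕ} (r : Fin n) : FreeAlgebra ℂ (HeckeGen n) := FreeAlgebra.ι ℂ (HeckeGen.x r)

/-- The generator `s_{i+1}` in the free algebra. -/
def freeS {n : ℕ} (i : Fin (n - 1)) : FreeAlgebra ℂ (HeckeGen n) := FreeAlgebra.ι ℂ (HeckeGen.s i)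

/-- The defining relations, for the cyclotomic parameter `(κ 0, κ 1)`. -/
inductive HeckeRel (κ : Fin 2 → ℂ) (n : ℕ) :
    FreeAlgebra ℂ (HeckeGen n) → FreeAlgebra ℂ (HeckeGen n) → Prop
  | cyclotomic (h : 0 < n) :
      HeckeRel κ n ((freeX ⟨0, h⟩ - algebraMap ℂ _ (κ 0)) * (freeX ⟨0, h⟩ - algebraMap ℂ _ (κ 1))) 0
  | x_s (r : Fin n) (l : Fin (n - 1)) (h₁ : (r : ℕ) ≠ l) (h₂ : (r : ℕ) ≠ l + 1) :
      HeckeRel κ n (freeX r * freeS l) (freeS l * freeX r)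
  | x_x (r u : Fin n) : HeckeRel κ n (freeX r * freeX u) (freeX u * freeX r)
  | x_succ (r : ℕ) (h : r < n - 1) :
      HeckeRel κ n (freeX ⟨r + 1, by omega⟩)
        (freeS ⟨r, h⟩ * freeX ⟨r, by omega⟩ * freeS ⟨r, h⟩ + freeS ⟨r, h⟩)
  | s_sq (i : Fin (n - 1)) : HeckeRel κ n (freeS i * freeS i) 1
  | s_comm (i j : Fin (n - 1)) (h : (i : ℕ) + 1 < j ∨ (j : ℕ) + 1 < i) :
      HeckeRel κ n (freeS i * freeS j) (freeS j * freeS i)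
  | braid (i : ℕ) (h : i + 1 < n - 1) :
      HeckeRel κ n (freeS ⟨i, by omega⟩ * freeS ⟨i + 1, h⟩ * freeS ⟨i, by omega⟩)
        (freeS ⟨i + 1, h⟩ * freeS ⟨i, by omega⟩ * freeS ⟨i + 1, h⟩)

/-- The cyclotomic degenerate affine Hecke algebra with cyclotomic parameter `κ`. For `n = 0` there
is no generator and it is `ℂ`. -/
def Hecke (κ : Fin 2 → ℂ) (n : ℕ) : Type := RingQuot (HeckeRel κ n)

namespace Hecke

variable {κ : Fin 2 → ℂ} {m n : ℕ}

instance : Ring (Hecke κ n) := inferInstanceAs (Ring (RingQuot (HeckeRel κ n)))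

instance : Algebra ℂ (Hecke κ n) := inferInstanceAs (Algebra ℂ (RingQuot (HeckeRel κ n)))

/-- The projection from the free algebra. -/
def mk (κ : Fin 2 → ℂ) (n : ℕ) : FreeAlgebra ℂ (HeckeGen n) →ₐ[ℂ] Hecke κ n :=
  RingQuot.mkAlgHom ℂ (HeckeRel κ n)

theorem mk_rel {a b : FreeAlgebra ℂ (HeckeGen n)} (h : HeckeRel κ n a b) :
    mk κ n a = mk κ n b :=
  RingQuot.mkAlgHom_rel ℂ h

/-- The Jucys–Murphy element `x_{r+1}`. -/
def x (r : Fin n) : Hecke κ n := mk κ n (freeX r)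

/-- The Coxeter element `s_{i+1}`. -/
def s (i : Fin (n - 1)) : Hecke κ n := mk κ n (freeS i)

/-- The generators of the algebra on `m` strands, in the algebra on `n ≥ m` strands. -/
def inclGen (h : m ≤ n) : HeckeGen m → Hecke κ n
  | HeckeGen.x r => x (Fin.castLE h r)
  | HeckeGen.s i => s (Fin.castLE (Nat.sub_le_sub_right h 1) i)

theorem lift_freeX (h : m ≤ n) (r : Fin m) :
    FreeAlgebra.lift ℂ (inclGen (κ := κ) h) (freeX r) = mk κ n (freeX (Fin.castLE h r)) :=
  FreeAlgebra.lift_ι_apply _ _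

theorem lift_freeS (h : m ≤ n) (i : Fin (m - 1)) :
    FreeAlgebra.lift ℂ (inclGen (κ := κ) h) (freeS i)
      = mk κ n (freeS (Fin.castLE (Nat.sub_le_sub_right h 1) i)) :=
  FreeAlgebra.lift_ι_apply _ _

/-- The natural morphism from the algebra on `m` strands to the algebra on `n ≥ m` strands, sending
each generator to the generator with the same name. -/
def incl (κ : Fin 2 → ℂ) (h : m ≤ n) : Hecke κ m →ₐ[ℂ] Hecke κ n :=
  RingQuot.liftAlgHom ℂ ⟨FreeAlgebra.lift ℂ (inclGen h), by
    intro a b hab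
    cases hab with
    | cyclotomic h0 =>
      simp only [map_mul, map_sub, map_zero, lift_freeX, AlgHom.commutes]
      simpa using mk_rel (HeckeRel.cyclotomic (κ := κ) (n := n) (h0.trans_le h))
    | x_s r l h₁ h₂ =>
      simpa only [map_mul, lift_freeX, lift_freeS] using
        mk_rel (HeckeRel.x_s (κ := κ) (Fin.castLE h r) (Fin.castLE _ l) h₁ h₂)
    | x_x r u =>
      simpa only [map_mul, lift_freeX] using
        mk_rel (HeckeRel.x_x (κ := κ) (Fin.castLE h r) (Fin.castLE h u))
    | x_succ r hr =>
      simpa only [map_mul, map_add, lift_freeX, lift_freeS, Fin.castLE_mk] using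
        mk_rel (HeckeRel.x_succ (κ := κ) (n := n) r (by omega))
    | s_sq i =>
      simpa only [map_mul, map_one, lift_freeS] using
        mk_rel (HeckeRel.s_sq (κ := κ) (n := n) (Fin.castLE (Nat.sub_le_sub_right h 1) i))
    | s_comm i j hij =>
      simpa only [map_mul, lift_freeS] using
        mk_rel (HeckeRel.s_comm (κ := κ) (n := n) (Fin.castLE (Nat.sub_le_sub_right h 1) i)
          (Fin.castLE (Nat.sub_le_sub_right h 1) j) hij)
    | braid i hi =>
      simpa only [map_mul, lift_freeS, Fin.castLE_mk] using
        mk_rel (HeckeRel.braid (κ := κ) (n := n) i (by omega))⟩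

end Hecke

/-! ### Standard bitableaux and idempotents -/

/-- A standard tableau of shape a bipartition of `m`: the entry `i+1` is in the box `pos i`, where a
box is given by its component, its row and its column (rows and columns are counted from `0`), and
the entries increase along the rows and down the columns of each of the two diagrams. -/
structure StdBitableau (m : ℕ) where
  shape : Fin 2 → YoungDiagram
  pos : Fin m ≃ {p : Fin 2 × ℕ × ℕ // p.2 ∈ shape p.1}
  standard : ∀ i j, (pos i).1.1 = (pos j).1.1 → (pos i).1.2 ≤ (pos j).1.2 → i ≤ j

/-- The content of the entry `i+1`: `κ_l + c - r` for a box in component `l`, row `r`,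
column `c`. -/
def StdBitableau.content {m : ℕ} (κ : Fin 2 → ℂ) (T : StdBitableau m) (i : Fin m) : ℂ :=
  κ (T.pos i).1.1 + ((T.pos i).1.2.2 : ℂ) - ((T.pos i).1.2.1 : ℂ)

/-- The set of all contents of standard tableaux whose shape is a bipartition of `m`. -/
def contentSet (κ : Fin 2 → ℂ) (m : ℕ) : Set ℂ :=
  {c | ∃ (T : StdBitableau m) (i : Fin m), T.content κ i = c}

theorem contentSet_finite (κ : Fin 2 → ℂ) (m : ℕ) : (contentSet κ m).Finite := by
  refine (Set.toFinite (Set.range fun p : Fin 2 × Fin m × Fin m =>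
    κ p.1 + ((p.2.2 : ℕ) : ℂ) - ((p.2.1 : ℕ) : ℂ))).subset ?_
  rintro _ ⟨T, i, rfl⟩
  rcases hb : T.pos i with ⟨⟨l, r, c⟩, hmem⟩
  have hr : r < m := by
    have hinj : Function.Injective (fun a : Fin (r + 1) =>
        T.pos.symm ⟨(l, (a : ℕ), c), (T.shape l).up_left_mem (Nat.lt_succ_iff.1 a.2) le_rfl hmem⟩) := by
      intro a b hab
      have := T.pos.symm.injective hab
      simp only [Subtype.mk.injEq, Prod.mk.injEq] at this
      exact Fin.ext this.2.1
    simpa using Fintype.card_le_of_injective _ hinj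
  have hc : c < m := by
    have hinj : Function.Injective (fun a : Fin (c + 1) =>
        T.pos.symm ⟨(l, r, (a : ℕ)), (T.shape l).up_left_mem le_rfl (Nat.lt_succ_iff.1 a.2) hmem⟩) := by
      intro a b hab
      have := T.pos.symm.injective hab
      simp only [Subtype.mk.injEq, Prod.mk.injEq] at this
      exact Fin.ext this.2.2
    simpa using Fintype.card_le_of_injective _ hinj
  exact ⟨(l, ⟨r, hr⟩, ⟨c, hc⟩), by simp [StdBitableau.content, hb]⟩

/-- The element `F_T`: the product over the entries `i` of
`∏_{c ≠ c_i(T)} (x_i - c) / (c_i(T) - c)`, where `c` runs over the set of contents. -/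
def idempotentOf (κ : Fin 2 → ℂ) {m : ℕ} (T : StdBitableau m) : Hecke κ m :=
  (List.ofFn fun i : Fin m => Polynomial.aeval (Hecke.x (κ := κ) i)
    (∏ c ∈ (contentSet_finite κ m).toFinset.erase (T.content κ i),
      Polynomial.C (T.content κ i - c)⁻¹ * (Polynomial.X - Polynomial.C c))).prod

/-- The Young diagram that is a column of `m` boxes. -/
def columnDiagram (m : ℕ) : YoungDiagram where
  cells := Finset.range m ×ˢ {0}
  isLowerSet := by
    rintro ⟨r, c⟩ ⟨r', c'⟩ h hm
    have h1 : r' ≤ r := h.1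
    have h2 : c' ≤ c := h.2
    simp only [Finset.coe_product, Set.mem_prod, Finset.mem_coe, Finset.mem_range,
      Finset.mem_singleton] at hm ⊢
    omega

theorem mem_columnDiagram {m : ℕ} {p : ℕ × ℕ} : p ∈ columnDiagram m ↔ p.1 < m ∧ p.2 = 0 := by
  rw [← YoungDiagram.mem_cells]
  obtain ⟨r, c⟩ := p
  simp [columnDiagram, eq_comm]

/-- The standard tableau whose component `b` is a column of `m` boxes, the other one being empty. -/
def columnTableau (m : ℕ) (b : Fin 2) : StdBitableau m where
  shape l := if l = b then columnDiagram m else ⊥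
  pos :=
    { toFun := fun i => ⟨(b, (i : ℕ), 0), by simp [mem_columnDiagram]⟩
      invFun := fun p => ⟨p.1.2.1, by
        obtain ⟨⟨l, r, c⟩, hp⟩ := p
        by_cases hl : l = b
        · simp only [hl, if_true, mem_columnDiagram] at hp
          exact hp.1
        · simp [hl] at hp⟩
      left_inv := fun i => rfl
      right_inv := fun p => by
        obtain ⟨⟨l, r, c⟩, hp⟩ := p
        by_cases hl : l = b
        · subst hl
          simp only [if_true, mem_columnDiagram] at hp
          simp [hp.2]
        · simp [hl] at hp }
  standard := fun i j _ h => h.1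

/-- The idempotent `F_m^{(-1, κ_b)}`, which corresponds to the one-dimensional representation
`x_1 ↦ κ_b`, `s_i ↦ -1`. -/
def signIdempotent (κ : Fin 2 → ℂ) (m : ℕ) (b : Fin 2) : Hecke κ m :=
  idempotentOf κ (columnTableau m b)

/-! ### The quotient algebra -/

/-- The relation on `x₁` and `s₁` that is imposed when `n ≥ 2`. -/
inductive QuotRel (κ : Fin 2 → ℂ) (n : ℕ) : Hecke κ n → Hecke κ n → Prop
  | rel (h : 2 ≤ n) (x₁ s₁ : Hecke κ n) (hx : x₁ = Hecke.x ⟨0, by omega⟩)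
      (hs : s₁ = Hecke.s ⟨0, by omega⟩) :
      QuotRel κ n ((x₁ * s₁) ^ 2)
        ((κ 0 * (1 + κ 0)) • (s₁ - 1) + κ 0 • (s₁ * x₁ * s₁ - s₁ * x₁)
          + (1 + κ 0) • (x₁ - x₁ * s₁) + x₁ * s₁ * x₁)

/-- The quotient `A_n^κ` of the cyclotomic degenerate affine Hecke algebra; it is the whole algebra
if `n` is `0` or `1`. -/
def HeckeQuot (κ : Fin 2 → ℂ) (n : ℕ) : Type := RingQuot (QuotRel κ n)

namespace HeckeQuot

variable {κ : Fin 2 → ℂ} {n : ℕ}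

instance : Ring (HeckeQuot κ n) := inferInstanceAs (Ring (RingQuot (QuotRel κ n)))

instance : Algebra ℂ (HeckeQuot κ n) := inferInstanceAs (Algebra ℂ (RingQuot (QuotRel κ n)))

/-- The projection. -/
def mk (κ : Fin 2 → ℂ) (n : ℕ) : Hecke κ n →ₐ[ℂ] HeckeQuot κ n :=
  RingQuot.mkAlgHom ℂ (QuotRel κ n)

end HeckeQuot

/-! ### Signed permutations -/

/-- The group of signed permutations. The pair `(i, false)` is the number `i+1`, the pair
`(i, true)` is the barred number `-(i+1)`. -/
def SignedPerm (n : ℕ) : Subgroup (Equiv.Perm (Fin n × Bool)) where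
  carrier := {w | ∀ i b, w (i, !b) = ((w (i, b)).1, !(w (i, b)).2)}
  one_mem' := fun _ _ => rfl
  mul_mem' := by
    intro v w hv hw i b
    simp only [Equiv.Perm.mul_apply]
    rw [hw i b, hv]
  inv_mem' := by
    intro w hw i b
    rw [Equiv.Perm.inv_eq_iff_eq, hw]
    simp

namespace SignedPerm

variable {n : ℕ}

/-- `τ_0` exchanges `1` and `-1`; for `1 ≤ j < n`, `τ_j` exchanges `j` and `j+1`, and also `-j` and
`-(j+1)`. -/
def tau (n : ℕ) (j : Fin n) : SignedPerm n :=
  if h : (j : ℕ) = 0 then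
    ⟨Equiv.swap (j, false) (j, true), by
      intro i b
      by_cases hi : i = j
      · subst hi; cases b <;> simp
      · rw [Equiv.swap_apply_of_ne_of_ne, Equiv.swap_apply_of_ne_of_ne] <;> simp [hi]⟩
  else
    ⟨Equiv.prodCongr (Equiv.swap ⟨j - 1, by omega⟩ j) (Equiv.refl Bool), fun _ _ => rfl⟩

/-- The barred numbers in the word `w(1) w(2) … w(n)` appear in decreasing order (of the underlying
numbers). -/
def Avoids (w : SignedPerm n) : Prop :=
  ∀ i j : Fin n, i < j → (w.1 (i, false)).2 = true → (w.1 (j, false)).2 = true →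
    (w.1 (j, false)).1 < (w.1 (i, false)).1

/-- The list `j, j-1, …, 1, 0, 1, …, j` of indices of generators. -/
def fullWord (j : Fin n) : List (Fin n) :=
  (List.ofFn fun a : Fin (j + 1) => (⟨j - a, by omega⟩ : Fin n)) ++
    List.ofFn fun a : Fin j => (⟨a + 1, by omega⟩ : Fin n)

/-- Normal forms: for each `j = 0, …, n-1`, the choice of one of the `2(j+1)` prefixes of the word
`j, j-1, …, 1, 0, 1, …, j`, given by its length. -/
abbrev NormalForm (n : ℕ) : Type := (j : Fin n) → Fin (2 * (j + 1))

/-- The word of a normal form: the concatenation of the chosen prefixes for `j = 0, …, n-1`. -/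
def NormalForm.word (c : NormalForm n) : List (Fin n) :=
  (List.ofFn fun j : Fin n => (fullWord j).take (c j)).flatten

/-- The signed permutation `τ_{i_1} ⋯ τ_{i_l}` of a normal form with word `i_1, …, i_l`. -/
def NormalForm.toSignedPerm (c : NormalForm n) : SignedPerm n := (c.word.map (tau n)).prod

instance : Nonempty (NormalForm n) := ⟨fun _ => ⟨0, by omega⟩⟩

/-- The normal form of a signed permutation (each signed permutation has exactly one). -/
def normalForm (w : SignedPerm n) : NormalForm n := Function.invFun NormalForm.toSignedPerm w

end SignedPerm

namespace Hecke

variable {κ : Fin 2 → ℂ} {n : ℕ}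

/-- The generator `s_j` for `1 ≤ j < n`, with `s_0 = x_1`. -/
def sB (κ : Fin 2 → ℂ) (j : Fin n) : Hecke κ n :=
  if h : (j : ℕ) = 0 then x j else s ⟨j - 1, by omega⟩

/-- The element `s_w = s_{i_1} ⋯ s_{i_l}`, where `τ_{i_1} ⋯ τ_{i_l}` is the normal form of `w`. -/
def sOf (κ : Fin 2 → ℂ) (w : SignedPerm n) : Hecke κ n :=
  ((SignedPerm.normalForm w).word.map (sB κ)).prod

end Hecke

end

/-! The diagrams are permutations of `k + n` dots modulo permutations of the `k` thick dots on both
sides. The gluing map from the group algebra is only linear, but by `glueLin_mul` it is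
multiplicative as soon as the right factor commutes with the thick permutations. The thin
transpositions and the Jucys–Murphy elements `jm k r` of the thin dots do commute with them. With
`x_r ↦ 1 + jm k r`, every Hecke relation except the cyclotomic one already holds in the group
algebra, and the cyclotomic one appears after gluing (`glueLin_jm_zero_sq`). This gives `phi`.
Surjectivity is an induction on the number of edges joining a thin bottom dot to the thick top point
(`ofDiagram_fuse_mem_range`).

For `κ = (0, c)` the relation defining the quotient is exactly `x₁ x₂ (1 - s₁) = 0`
(`quotRel_sub_eq_gap`). It holds for diagrams because `(1 + J₁)(1 + J₂)` is, after gluing, a sum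
over all ways of choosing the edges that reach two thin top points, hence insensitive to exchanging
their bottom ends (`glueLin_mul_swap`).

The rest is a dimension count. In any quotient of the Hecke algebra, the products `X_I T_w` span,
and they are filtered by `|I|`. Modulo lower terms, `T_u` permutes the indices of `X_I`
(`perm_mul_prod`), and once `x₁ x₂ (1 - s₁) = 0` it may be absorbed by `X_I` if it is supported on
`I` (`prod_mul_perm`). The word of a signed permutation has leading term `X_I T_w`, with `I` its
barred values and `w` its underlying permutation (`prod_word_sub_mem_below`), so those with
decreasing bars suffice to span (`span_avoids_eq_top`). When `n ≤ k` these inject into the diagrams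
(`toFusedPerm_injOn`). A spanning family no larger than the dimension is a basis, which gives the
basis and the isomorphism together.

For the kernel, `F₂` and `x₁ x₂ (1 - s₁)` generate the same ideal: the latter is a joint eigenvector
on which `F₂` acts by `1` (`incl_signIdempotent_mul_gap`), and `F₂` has factors that vanish once the
latter is zero (`map_incl_signIdempotent`). -/

/-! ### The Coxeter presentation of the symmetric group -/

/-- The relations of a Coxeter family of type `A`, for the indices smaller than `N`. -/
structure IsCoxeterFamily {M : Type*} [Monoid M] (N : ℕ) (g : ℕ → M) : Prop where
  sq : ∀ i < N, g i * g i = 1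
  comm : ∀ i j, i + 1 < j → j < N → g i * g j = g j * g i
  braid : ∀ i, i + 1 < N → g i * g (i + 1) * g i = g (i + 1) * g i * g (i + 1)

/-- The adjacent transposition of `i` and `i + 1`. -/
def adjSwap (n i : ℕ) : Equiv.Perm (Fin n) :=
  if h : i + 1 < n then Equiv.swap ⟨i, by omega⟩ ⟨i + 1, h⟩ else 1

theorem adjSwap_of_lt {n i : ℕ} (h : i + 1 < n) :
    adjSwap n i = Equiv.swap ⟨i, by omega⟩ ⟨i + 1, h⟩ := dif_pos h

theorem swap_braid {α : Type*} [DecidableEq α] {a b c : α} (hab : a ≠ b) (hac : a ≠ c)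
    (hbc : b ≠ c) : Equiv.swap a b * Equiv.swap b c * Equiv.swap a b
      = Equiv.swap b c * Equiv.swap a b * Equiv.swap b c := by
  rw [Equiv.mul_swap_eq_swap_mul, Equiv.Perm.mul_apply, Equiv.Perm.mul_apply,
    Equiv.swap_apply_of_ne_of_ne hab hac, Equiv.swap_apply_left, Equiv.swap_apply_left,
    Equiv.swap_apply_of_ne_of_ne hac.symm hbc.symm, mul_assoc]

theorem isCoxeterFamily_adjSwap (n : ℕ) : IsCoxeterFamily (n - 1) (adjSwap n) where
  sq i hi := by rw [adjSwap_of_lt (by omega), Equiv.swap_mul_self]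
  comm i j hij hj := by
    rw [adjSwap_of_lt (by omega), adjSwap_of_lt (by omega), Equiv.mul_swap_eq_swap_mul,
      Equiv.swap_apply_of_ne_of_ne, Equiv.swap_apply_of_ne_of_ne] <;> simp <;> omega
  braid i hi := by
    rw [adjSwap_of_lt (by omega), adjSwap_of_lt (by omega)]
    apply swap_braid <;> (simp; try omega)

namespace IsCoxeterFamily

variable {M : Type*} [Monoid M] {N : ℕ} {g : ℕ → M}

/-- Pairing a family with the adjacent transpositions makes a single rewriting of words valid in
both monoids at once. -/
theorem prod {M' : Type*} [Monoid M'] {g' : ℕ → M'} (hg : IsCoxeterFamily N g)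
    (hg' : IsCoxeterFamily N g') : IsCoxeterFamily N fun i => (g i, g' i) where
  sq i hi := Prod.ext (hg.sq i hi) (hg'.sq i hi)
  comm i j h hj := Prod.ext (hg.comm i j h hj) (hg'.comm i j h hj)
  braid i hi := Prod.ext (hg.braid i hi) (hg'.braid i hi)

theorem commute_prod (hg : IsCoxeterFamily N g) {i : ℕ} {l : List ℕ}
    (hl : ∀ j ∈ l, i + 1 < j ∧ j < N) : g i * (l.map g).prod = (l.map g).prod * g i := by
  refine (Commute.list_prod_right _ _ fun x hx => ?_ : Commute (g i) _)
  obtain ⟨j, hj, rfl⟩ := List.mem_map.1 hx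
  exact hg.comm i j (hl j hj).1 (hl j hj).2

/-- The letter commutes with the run until it meets its left neighbour; one braid move then lowers
its index, and it commutes with what remains. -/
theorem mul_prod_range' (hg : IsCoxeterFamily N g) (L : ℕ) : ∀ p i, p < i → i < p + L →
    p + L ≤ N → g i * ((List.range' p L).map g).prod = ((List.range' p L).map g).prod * g (i - 1) := by
  induction L with
  | zero => intro p i h1 h2; omega
  | succ L ih =>
    intro p i h1 h2 h3
    rw [List.range'_succ, List.map_cons, List.prod_cons]
    rcases Nat.lt_or_ge (p + 1) i with h | h
    · rw [← mul_assoc, ← hg.comm p i h (by omega), mul_assoc, ih (p + 1) i h (by omega) (by omega),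
        mul_assoc]
    · obtain rfl : i = p + 1 := by omega
      obtain ⟨L, rfl⟩ : ∃ L', L = L' + 1 := ⟨L - 1, by omega⟩
      rw [List.range'_succ, List.map_cons, List.prod_cons, Nat.add_sub_cancel]
      have hc := hg.commute_prod (i := p) (l := List.range' (p + 1 + 1) L) fun j hj => by
        rw [List.mem_range'_1] at hj; omega
      rw [← mul_assoc, ← mul_assoc, ← hg.braid p (by omega)]
      simp only [mul_assoc, hc]

/-- Every word is the product of a representative of a coset of a smaller symmetric group and of a
word of this smaller group. -/
theorem exists_coset_word (hg : IsCoxeterFamily N g) {m : ℕ} (hm : m < N) (l : List ℕ)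
    (hl : ∀ i ∈ l, i < m + 1) : ∃ p ≤ m + 1, ∃ l' : List ℕ, (∀ i ∈ l', i < m) ∧
      (l.map g).prod = ((List.range' p (m + 1 - p)).map g).prod * (l'.map g).prod := by
  induction l with
  | nil => exact ⟨m + 1, le_rfl, [], by simp, by simp⟩
  | cons i l ih =>
    obtain ⟨p, hp, l', hl', e⟩ := ih fun j hj => hl j (List.mem_cons_of_mem _ hj)
    have hi := hl i List.mem_cons_self
    rw [List.map_cons, List.prod_cons, e, ← mul_assoc]
    -- The new letter `i` meets the run `p, …, m`: it passes through unchanged if `i + 1 < p`,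
    -- prolongs the run if `i + 1 = p`, cancels its first letter if `i = p`, and passes through with
    -- index `i - 1` if `i > p`.
    rcases lt_trichotomy i p with h | rfl | h
    · rcases Nat.lt_or_ge (i + 1) p with h' | h'
      · refine ⟨p, hp, i :: l', by simp only [List.mem_cons]; rintro j (rfl | hj)
                                   · omega
                                   · exact hl' j hj, ?_⟩
        rw [hg.commute_prod, List.map_cons, List.prod_cons, mul_assoc]
        intro j hj
        rw [List.mem_range'_1] at hj; omega
      · obtain rfl : p = i + 1 := by omega
        refine ⟨i, by omega, l', hl', ?_⟩
        rw [show m + 1 - i = m + 1 - (i + 1) + 1 by omega, List.range'_succ, List.map_cons,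
          List.prod_cons]
    · refine ⟨i + 1, by omega, l', hl', ?_⟩
      rw [show m + 1 - i = m + 1 - (i + 1) + 1 by omega, List.range'_succ, List.map_cons,
        List.prod_cons, ← mul_assoc, hg.sq i (by omega), one_mul]
    · refine ⟨p, hp, (i - 1) :: l', by simp only [List.mem_cons]; rintro j (rfl | hj)
                                       · omega
                                       · exact hl' j hj, ?_⟩
      rw [hg.mul_prod_range' _ p i h (by omega) (by omega), List.map_cons, List.prod_cons,
        mul_assoc]

end IsCoxeterFamily

/-- The image of the last point recovers the start of the run, hence the coset. -/
theorem adjSwap_prod_range' {n : ℕ} (L : ℕ) : ∀ (p : ℕ) (h : p + L < n),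
    ((List.range' p L).map (adjSwap n)).prod ⟨p + L, h⟩ = ⟨p, by omega⟩ := by
  induction L with
  | zero => intro p h; simp
  | succ L ih =>
    intro p h
    have := ih (p + 1) (by omega)
    rw [List.range'_succ, List.map_cons, List.prod_cons, Equiv.Perm.mul_apply]
    simp only [Nat.add_right_comm p 1 L, ← add_assoc] at this ⊢
    rw [this, adjSwap_of_lt (by omega), Equiv.swap_apply_right]

theorem adjSwap_prod_apply_of_lt {n m : ℕ} (l : List ℕ) (hl : ∀ i ∈ l, i < m) (h : m + 1 < n) :
    (l.map (adjSwap n)).prod ⟨m + 1, h⟩ = ⟨m + 1, h⟩ := by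
  induction l with
  | nil => rfl
  | cons i l ih =>
    have := hl i List.mem_cons_self
    rw [List.map_cons, List.prod_cons, Equiv.Perm.mul_apply,
      ih fun j hj => hl j (List.mem_cons_of_mem _ hj), adjSwap_of_lt (by omega),
      Equiv.swap_apply_of_ne_of_ne] <;> simp <;> omega

namespace IsCoxeterFamily

variable {M : Type*} [Monoid M] {n : ℕ} {g : ℕ → M}

theorem prod_eq_one (hg : IsCoxeterFamily (n - 1) g) (m : ℕ) (hm : m ≤ n - 1) :
    ∀ l : List ℕ, (∀ i ∈ l, i < m) → (l.map (adjSwap n)).prod = 1 → (l.map g).prod = 1 := by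
  induction m with
  | zero =>
    intro l hl _
    rw [List.eq_nil_iff_forall_not_mem.2 fun i hi => absurd (hl i hi) (by omega)]
    rfl
  | succ m ih =>
    intro l hl h1
    obtain ⟨p, hp, l', hl', e⟩ :=
      (hg.prod (isCoxeterFamily_adjSwap n)).exists_coset_word (by omega) l hl
    have split : ∀ l : List ℕ, (l.map fun i => (g i, adjSwap n i)).prod
        = ((l.map g).prod, (l.map (adjSwap n)).prod) := by
      intro l
      induction l with
      | nil => rfl
      | cons i l ih => simp [ih]
    rw [split, split, split, Prod.mk_mul_mk, Prod.mk.injEq] at e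
    -- The smaller word fixes the point `m + 1` and the run sends it to `p`; a trivial product
    -- therefore has an empty run.
    have hp' : p = m + 1 := by
      have h2 := congrArg (fun w => w ⟨m + 1, by omega⟩) e.2
      simp only [h1, Equiv.Perm.mul_apply] at h2
      rw [adjSwap_prod_apply_of_lt l' hl' (by omega)] at h2
      have h3 := adjSwap_prod_range' (n := n) (m + 1 - p) p (by omega)
      simp only [Nat.add_sub_cancel' hp] at h3
      rw [h3] at h2
      simpa using h2.symm
    subst hp'
    simp only [Nat.sub_self, List.range'_zero, List.map_nil, List.prod_nil, one_mul] at e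
    rw [e.1]
    exact ih (by omega) l' hl' (e.2 ▸ h1)

theorem prod_reverse_mul_prod {N : ℕ} (hg : IsCoxeterFamily N g) (l : List ℕ)
    (hl : ∀ i ∈ l, i < N) : (l.reverse.map g).prod * (l.map g).prod = 1 := by
  induction l with
  | nil => simp
  | cons i l ih =>
    rw [List.reverse_cons, List.map_append, List.prod_append, List.map_cons, List.prod_cons,
      List.map_cons, List.map_nil, List.prod_cons, List.prod_nil, mul_one, mul_assoc,
      ← mul_assoc (g i),
      hg.sq i (hl i List.mem_cons_self), one_mul, ih fun j hj => hl j (List.mem_cons_of_mem _ hj)]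

theorem prod_eq_prod (hg : IsCoxeterFamily (n - 1) g) {l l' : List ℕ} (hl : ∀ i ∈ l, i < n - 1)
    (hl' : ∀ i ∈ l', i < n - 1) (h : (l.map (adjSwap n)).prod = (l'.map (adjSwap n)).prod) :
    (l.map g).prod = (l'.map g).prod := by
  have h1 := hg.prod_eq_one (n - 1) le_rfl (l'.reverse ++ l) (by
    simp only [List.mem_append, List.mem_reverse]
    rintro i (hi | hi)
    exacts [hl' i hi, hl i hi]) (by
    rw [List.map_append, List.prod_append, h,
      (isCoxeterFamily_adjSwap n).prod_reverse_mul_prod l' hl'])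
  have h2 := hg.prod_reverse_mul_prod l'.reverse fun i hi => hl' i (List.mem_reverse.1 hi)
  rw [List.reverse_reverse] at h2
  rw [List.map_append, List.prod_append] at h1
  calc (l.map g).prod = (l'.map g).prod * (l'.reverse.map g).prod * (l.map g).prod := by
        rw [h2, one_mul]
    _ = _ := by rw [mul_assoc, h1, mul_one]

end IsCoxeterFamily

theorem exists_adjSwap_word {n : ℕ} (w : Equiv.Perm (Fin n)) :
    ∃ l : List ℕ, (∀ i ∈ l, i < n - 1) ∧ (l.map (adjSwap n)).prod = w := by
  rcases n with _ | n
  · exact ⟨[], by simp, Subsingleton.elim _ _⟩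
  have hw : w ∈ Submonoid.closure (Set.range fun i : Fin n => Equiv.swap i.castSucc i.succ) := by
    rw [Equiv.Perm.mclosure_swap_castSucc_succ]; trivial
  induction hw using Submonoid.closure_induction with
  | mem x hx =>
    obtain ⟨i, rfl⟩ := hx
    refine ⟨[i], by simp, ?_⟩
    simp only [List.map_cons, List.map_nil, List.prod_singleton]
    rw [adjSwap_of_lt (by omega)]
    rfl
  | one => exact ⟨[], by simp, rfl⟩
  | mul x y _ _ hx hy =>
    obtain ⟨l, hl, rfl⟩ := hx
    obtain ⟨l', hl', rfl⟩ := hy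
    refine ⟨l ++ l', ?_, by simp⟩
    simp only [List.mem_append]
    rintro i (hi | hi)
    exacts [hl i hi, hl' i hi]

/-- A family satisfying the Coxeter relations of type `A` extends to the symmetric group. -/
theorem IsCoxeterFamily.exists_hom {M : Type*} [Monoid M] {n : ℕ} {g : ℕ → M}
    (hg : IsCoxeterFamily (n - 1) g) :
    ∃ T : Equiv.Perm (Fin n) →* M, ∀ i < n - 1, T (adjSwap n i) = g i := by
  choose W hW hW' using exists_adjSwap_word (n := n)
  refine ⟨⟨⟨fun w => ((W w).map g).prod, ?_⟩, fun u v => ?_⟩, fun i hi => ?_⟩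
  · exact hg.prod_eq_prod (l' := []) (hW 1) (by simp) (by rw [hW']; rfl)
  · change _ = ((W u).map g).prod * ((W v).map g).prod
    rw [← List.prod_append, ← List.map_append]
    refine hg.prod_eq_prod (hW _) ?_ (by rw [hW', List.map_append, List.prod_append, hW', hW'])
    simp only [List.mem_append]
    rintro i (hi | hi)
    exacts [hW _ i hi, hW _ i hi]
  · change ((W (adjSwap n i)).map g).prod = _
    rw [hg.prod_eq_prod (l' := [i]) (hW _) (by simpa using hi) (by rw [hW']; simp)]
    simp

/-- An induction principle for permutations, by left multiplication by adjacent transpositions. -/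
theorem adjSwap_induction {n : ℕ} {P : Equiv.Perm (Fin n) → Prop} (h1 : P 1)
    (hmul : ∀ i < n - 1, ∀ w, P w → P (adjSwap n i * w)) (w : Equiv.Perm (Fin n)) : P w := by
  obtain ⟨l, hl, rfl⟩ := exists_adjSwap_word w
  induction l with
  | nil => exact h1
  | cons i l ih =>
    rw [List.map_cons, List.prod_cons]
    exact hmul i (hl i List.mem_cons_self) _ (ih fun j hj => hl j (List.mem_cons_of_mem _ hj))

/-! ### Families of Jucys–Murphy type -/

/-- A commuting family `X` and a morphism `T` from the symmetric group that satisfy the relations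
of the degenerate affine Hecke algebra, with a quadratic relation for the first element of `X`. -/
structure IsJucysMurphy {A : Type*} [Ring A] [Algebra ℂ A] {n : ℕ} (X : Fin n → A)
    (T : Equiv.Perm (Fin n) →* A) (c : ℂ) : Prop where
  comm : ∀ i j, X i * X j = X j * X i
  swap_mul : ∀ i (h : i + 1 < n),
    T (adjSwap n i) * X ⟨i, by omega⟩ = X ⟨i + 1, h⟩ * T (adjSwap n i) - 1
  swap_comm : ∀ i (_ : i + 1 < n) (j : Fin n), (j : ℕ) ≠ i → (j : ℕ) ≠ i + 1 →
    T (adjSwap n i) * X j = X j * T (adjSwap n i)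
  sq : ∀ h : 0 < n, X ⟨0, h⟩ * X ⟨0, h⟩ = c • X ⟨0, h⟩

namespace IsJucysMurphy

variable {A : Type*} [Ring A] [Algebra ℂ A] {n : ℕ} {X : Fin n → A}
  {T : Equiv.Perm (Fin n) →* A} {c : ℂ}

omit [Algebra ℂ A] in
theorem swap_sq (i : ℕ) (h : i + 1 < n) : T (adjSwap n i) * T (adjSwap n i) = 1 := by
  rw [← map_mul, (isCoxeterFamily_adjSwap n).sq i (by omega), map_one]

theorem swap_mul_succ (H : IsJucysMurphy X T c) (i : ℕ) (h : i + 1 < n) :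
    T (adjSwap n i) * X ⟨i + 1, h⟩ = X ⟨i, by omega⟩ * T (adjSwap n i) + 1 := by
  have h1 := congrArg (fun a => T (adjSwap n i) * a * T (adjSwap n i)) (H.swap_mul i h)
  simp only [mul_sub, sub_mul, mul_one] at h1
  rw [← mul_assoc, swap_sq i h, one_mul, mul_assoc (T _), mul_assoc (X _), swap_sq i h,
    mul_one] at h1
  rw [h1, sub_add_cancel]

/-- The product of the elements `X i` for `i ∈ I`. -/
noncomputable def prod (H : IsJucysMurphy X T c) (I : Finset (Fin n)) : A :=
  I.noncommProd X fun i _ j _ _ => H.comm i j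

variable (H : IsJucysMurphy X T c)
include H

theorem prod_empty : H.prod ∅ = 1 := Finset.noncommProd_empty _ _

theorem prod_insert {i : Fin n} {I : Finset (Fin n)} (hi : i ∉ I) :
    H.prod (insert i I) = X i * H.prod I := Finset.noncommProd_insert_of_notMem _ _ _ _ hi

theorem swap_mul_prod_of_notMem {i : ℕ} (h : i + 1 < n) {I : Finset (Fin n)}
    (h1 : ⟨i, by omega⟩ ∉ I) (h2 : ⟨i + 1, h⟩ ∉ I) :
    T (adjSwap n i) * H.prod I = H.prod I * T (adjSwap n i) :=
  Finset.noncommProd_commute _ _ _ _ fun j hj => H.swap_comm i h j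
    (fun e => h1 (by convert hj using 1; exact Fin.ext e.symm))
    (fun e => h2 (by convert hj using 1; exact Fin.ext e.symm))

/-- The span of the products `X_I T_w` with `I` of cardinality smaller than `r`. -/
def below (r : ℕ) : Submodule ℂ A :=
  Submodule.span ℂ {a | ∃ (I : Finset (Fin n)) (w : Equiv.Perm (Fin n)), I.card < r ∧
    a = H.prod I * T w}

theorem prod_mul_mem_below {r : ℕ} {I : Finset (Fin n)} (hI : I.card < r)
    (w : Equiv.Perm (Fin n)) : H.prod I * T w ∈ H.below r :=
  Submodule.subset_span ⟨I, w, hI, rfl⟩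

theorem prod_mem_below {r : ℕ} {I : Finset (Fin n)} (hI : I.card < r) : H.prod I ∈ H.below r := by
  simpa using H.prod_mul_mem_below hI 1

theorem below_mono {r s : ℕ} (h : r ≤ s) : H.below r ≤ H.below s :=
  Submodule.span_mono fun _ ⟨I, w, hI, e⟩ => ⟨I, w, hI.trans_le h, e⟩

theorem mul_mem_below {r s : ℕ} {a : A}
    (h : ∀ (I : Finset (Fin n)) w, I.card < r → a * (H.prod I * T w) ∈ H.below s)
    {v : A} (hv : v ∈ H.below r) : a * v ∈ H.below s := by
  have : H.below r ≤ (H.below s).comap (LinearMap.mulLeft ℂ a) :=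
    Submodule.span_le.2 (by rintro _ ⟨I, w, hI, rfl⟩; exact h I w hI)
  exact this hv

theorem mul_perm_mem_below {r : ℕ} {v : A} (hv : v ∈ H.below r) (u : Equiv.Perm (Fin n)) :
    v * T u ∈ H.below r := by
  have : H.below r ≤ (H.below r).comap (LinearMap.mulRight ℂ (T u)) := by
    refine Submodule.span_le.2 ?_
    · rintro _ ⟨I, w, hI, rfl⟩
      change H.prod I * T w * T u ∈ H.below r
      rw [mul_assoc, ← map_mul]
      exact H.prod_mul_mem_below hI _
  exact this hv

/-- Exchanging a transposition with `X i` or `X (i+1)` costs a term `∓1`. If exactly one of the two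
indices lies in `I`, this leaves a product with one factor fewer; if both do, the two corrections
cancel. -/
theorem swap_mul_prod {i : ℕ} (h : i + 1 < n) (I : Finset (Fin n)) :
    T (adjSwap n i) * H.prod I
      - H.prod (I.map (adjSwap n i).toEmbedding) * T (adjSwap n i) ∈ H.below I.card := by
  have hab : (⟨i, by omega⟩ : Fin n) ≠ ⟨i + 1, h⟩ := by simp
  have hsa : adjSwap n i ⟨i, by omega⟩ = ⟨i + 1, h⟩ := by
    rw [adjSwap_of_lt h, Equiv.swap_apply_left]
  have hsb : adjSwap n i ⟨i + 1, h⟩ = ⟨i, by omega⟩ := by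
    rw [adjSwap_of_lt h, Equiv.swap_apply_right]
  have hmap : ∀ J : Finset (Fin n), ⟨i, by omega⟩ ∉ J → ⟨i + 1, h⟩ ∉ J →
      J.map (adjSwap n i).toEmbedding = J := by
    intro J h1 h2
    rw [Finset.map_eq_image]
    refine (Finset.image_congr fun j hj => ?_).trans Finset.image_id
    change adjSwap n i j = j
    rw [adjSwap_of_lt h]
    exact Equiv.swap_apply_of_ne_of_ne (by rintro rfl; exact h1 hj) (by rintro rfl; exact h2 hj)
  by_cases ha : (⟨i, by omega⟩ : Fin n) ∈ I <;> by_cases hb : (⟨i + 1, h⟩ : Fin n) ∈ I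
  · obtain ⟨I, ha', rfl⟩ : ∃ J, ⟨i, by omega⟩ ∉ J ∧ I = insert ⟨i, by omega⟩ J :=
      ⟨_, Finset.notMem_erase _ _, (Finset.insert_erase ha).symm⟩
    obtain ⟨I, hb', rfl⟩ : ∃ J, ⟨i + 1, h⟩ ∉ J ∧ I = insert ⟨i + 1, h⟩ J :=
      ⟨_, Finset.notMem_erase _ _,
        (Finset.insert_erase ((Finset.mem_insert.1 hb).resolve_left hab.symm)).symm⟩
    have ha'' : ⟨i, by omega⟩ ∉ I := fun hm => ha' (Finset.mem_insert_of_mem hm)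
    rw [Finset.map_insert, Finset.map_insert, hmap I ha'' hb']
    simp only [Equiv.coe_toEmbedding, hsa, hsb]
    rw [Finset.insert_comm (⟨i + 1, h⟩ : Fin n), H.prod_insert ha', H.prod_insert hb']
    have e : T (adjSwap n i) * (X ⟨i, by omega⟩ * (X ⟨i + 1, h⟩ * H.prod I))
        = X ⟨i, by omega⟩ * (X ⟨i + 1, h⟩ * H.prod I) * T (adjSwap n i) := by
      rw [← mul_assoc, H.swap_mul i h, sub_mul, mul_assoc, ← mul_assoc (T _), H.swap_mul_succ i h,
        add_mul, mul_add, mul_assoc (X _) (T _), H.swap_mul_prod_of_notMem h ha'' hb', one_mul,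
        one_mul, add_sub_cancel_right]
      simp only [← mul_assoc]
      rw [H.comm]
    rw [e, sub_self]
    exact zero_mem _
  · obtain ⟨I, ha', rfl⟩ : ∃ J, ⟨i, by omega⟩ ∉ J ∧ I = insert ⟨i, by omega⟩ J :=
      ⟨_, Finset.notMem_erase _ _, (Finset.insert_erase ha).symm⟩
    have hb' : ⟨i + 1, h⟩ ∉ I := fun hm => hb (Finset.mem_insert_of_mem hm)
    rw [Finset.map_insert, hmap I ha' hb']
    simp only [Equiv.coe_toEmbedding, hsa]
    rw [H.prod_insert ha', H.prod_insert hb', ← mul_assoc, H.swap_mul i h, sub_mul, mul_assoc,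
      H.swap_mul_prod_of_notMem h ha' hb', ← mul_assoc, one_mul, sub_sub_cancel_left]
    exact neg_mem (H.prod_mem_below (by rw [Finset.card_insert_of_notMem ha']; omega))
  · obtain ⟨I, hb', rfl⟩ : ∃ J, ⟨i + 1, h⟩ ∉ J ∧ I = insert ⟨i + 1, h⟩ J :=
      ⟨_, Finset.notMem_erase _ _, (Finset.insert_erase hb).symm⟩
    have ha' : ⟨i, by omega⟩ ∉ I := fun hm => ha (Finset.mem_insert_of_mem hm)
    rw [Finset.map_insert, hmap I ha' hb']
    simp only [Equiv.coe_toEmbedding, hsb]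
    rw [H.prod_insert ha', H.prod_insert hb', ← mul_assoc, H.swap_mul_succ i h, add_mul, mul_assoc,
      H.swap_mul_prod_of_notMem h ha' hb', ← mul_assoc, one_mul, add_sub_cancel_left]
    exact H.prod_mem_below (by rw [Finset.card_insert_of_notMem hb']; omega)
  · rw [hmap I ha hb, H.swap_mul_prod_of_notMem h ha hb, sub_self]
    exact zero_mem _

theorem swap_mul_mem_below {i : ℕ} (h : i + 1 < n) {r : ℕ} {v : A} (hv : v ∈ H.below r) :
    T (adjSwap n i) * v ∈ H.below r := by
  refine H.mul_mem_below (fun I w hI => ?_) hv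
  rw [← mul_assoc, ← sub_add_cancel (T _ * H.prod I) (H.prod _ * T (adjSwap n i)), add_mul]
  refine add_mem (H.mul_perm_mem_below (H.below_mono hI.le (H.swap_mul_prod h I)) w) ?_
  rw [mul_assoc, ← map_mul]
  exact H.prod_mul_mem_below (by rwa [Finset.card_map]) _

theorem perm_mul_mem_below {r : ℕ} {v : A} (hv : v ∈ H.below r) (u : Equiv.Perm (Fin n)) :
    T u * v ∈ H.below r := by
  induction u using adjSwap_induction with
  | h1 => simpa using hv
  | hmul i hi u ih =>
    rw [map_mul, mul_assoc]
    exact H.swap_mul_mem_below (by omega) ih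

theorem perm_mul_prod (u : Equiv.Perm (Fin n)) (I : Finset (Fin n)) :
    T u * H.prod I - H.prod (I.map u.toEmbedding) * T u ∈ H.below I.card := by
  induction u using adjSwap_induction with
  | h1 =>
    have : I.map (1 : Equiv.Perm (Fin n)).toEmbedding = I := Finset.map_refl
    rw [this]; simp
  | hmul i hi u ih =>
    have h1 := H.swap_mul_mem_below (i := i) (by omega) ih
    have h2 := H.swap_mul_prod (i := i) (by omega) (I.map u.toEmbedding)
    rw [Finset.card_map] at h2
    have h3 := add_mem h1 (H.mul_perm_mem_below h2 u)
    have e : (I.map u.toEmbedding).map (adjSwap n i).toEmbedding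
        = I.map (adjSwap n i * u).toEmbedding := by
      rw [Finset.map_map]; rfl
    rw [e] at h3
    convert h3 using 1
    rw [map_mul, mul_sub, sub_mul]
    simp only [mul_assoc]
    abel

/-- The quadratic relation turns a repeated first factor into a scalar, so square-free products are
enough. -/
theorem first_mul_mem_below (h : 0 < n) {r : ℕ} {v : A} (hv : v ∈ H.below r) :
    X ⟨0, h⟩ * v ∈ H.below (r + 1) := by
  refine H.mul_mem_below (fun I w hI => ?_) hv
  by_cases h0 : ⟨0, h⟩ ∈ I
  · obtain ⟨I, h0', rfl⟩ : ∃ J, ⟨0, h⟩ ∉ J ∧ I = insert ⟨0, h⟩ J :=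
      ⟨_, Finset.notMem_erase _ _, (Finset.insert_erase h0).symm⟩
    rw [H.prod_insert h0', mul_assoc, ← mul_assoc, H.sq, smul_mul_assoc, ← mul_assoc,
      ← H.prod_insert h0']
    exact Submodule.smul_mem _ _ (H.prod_mul_mem_below (by omega) w)
  · rw [← mul_assoc, ← H.prod_insert h0]
    exact H.prod_mul_mem_below (by rw [Finset.card_insert_of_notMem h0]; omega) w

/-- An index set has at most `n` elements, so the filtration is constant from stage `n + 1` on. -/
theorem first_mul_mem_below_top (h : 0 < n) {v : A} (hv : v ∈ H.below (n + 1)) :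
    X ⟨0, h⟩ * v ∈ H.below (n + 1) :=
  (Submodule.span_mono (by
    rintro _ ⟨I, w, _, e⟩
    exact ⟨I, w, Nat.lt_succ_of_le (by simpa using I.card_le_univ), e⟩) :
      H.below (n + 1 + 1) ≤ H.below (n + 1))
    (H.first_mul_mem_below h hv)

/-- Writing `X (i+1) = s X_i s + s` reduces everything to the first element and the transpositions.
-/
theorem mul_mem_below_top (i : Fin n) {v : A} (hv : v ∈ H.below (n + 1)) :
    X i * v ∈ H.below (n + 1) := by
  obtain ⟨i, hi⟩ := i
  induction i generalizing v with
  | zero => exact H.first_mul_mem_below_top hi hv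
  | succ i ih =>
    have e : X ⟨i + 1, hi⟩ = T (adjSwap n i) * (X ⟨i, by omega⟩ * T (adjSwap n i))
        + T (adjSwap n i) := by
      rw [← mul_assoc, H.swap_mul i hi, sub_mul, one_mul, mul_assoc, swap_sq i hi, mul_one,
        sub_add_cancel]
    rw [e, add_mul, mul_assoc, mul_assoc]
    exact add_mem (H.perm_mul_mem_below (ih (H.perm_mul_mem_below hv _) (by omega)) _)
      (H.perm_mul_mem_below hv _)

section Collapse

variable (hc : ∀ h : 1 < n, X ⟨0, by omega⟩ * X ⟨1, h⟩ * T (adjSwap n 0)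
  = X ⟨0, by omega⟩ * X ⟨1, h⟩)
include hc

/-- Modulo lower terms, `X_I` is the conjugate by `T w` of a product containing the first two
factors, and there the hypothesis `hc` applies. -/
theorem prod_mul_swap {i j : Fin n} (hij : i ≠ j) {I : Finset (Fin n)} (hi : i ∈ I) (hj : j ∈ I) :
    H.prod I * T (Equiv.swap i j) - H.prod I ∈ H.below I.card := by
  have hn : 1 < n := by
    have := i.2; have := j.2
    by_contra h
    exact hij (Fin.ext (by omega))
  let a : Fin n := ⟨0, by omega⟩
  let b : Fin n := ⟨1, hn⟩
  have hab : a ≠ b := by simp [a, b]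
  -- First bring `a` to `i`, then bring the image of `b` to `j`; the second transposition does not
  -- move `i`.
  obtain ⟨w, hwa, hwb⟩ : ∃ w : Equiv.Perm (Fin n), w a = i ∧ w b = j := by
    refine ⟨Equiv.swap (Equiv.swap a i b) j * Equiv.swap a i, ?_, ?_⟩
    · rw [Equiv.Perm.mul_apply, Equiv.swap_apply_left, Equiv.swap_apply_of_ne_of_ne _ hij]
      intro e
      rw [eq_comm, Equiv.swap_apply_eq_iff, Equiv.swap_apply_right] at e
      exact hab e.symm
    · rw [Equiv.Perm.mul_apply, Equiv.swap_apply_left]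
  obtain ⟨J, rfl⟩ : ∃ J : Finset (Fin n), I = J.map w.toEmbedding :=
    ⟨I.map w.symm.toEmbedding, by
      rw [Finset.map_map]
      exact (Finset.map_refl.symm.trans (by congr 1; ext x; simp))⟩
  have ha : a ∈ J := by
    obtain ⟨x, hx, e⟩ := Finset.mem_map.1 hi
    rwa [← w.injective (e.trans hwa.symm)]
  have hb : b ∈ J := by
    obtain ⟨x, hx, e⟩ := Finset.mem_map.1 hj
    rwa [← w.injective (e.trans hwb.symm)]
  -- This equality is exact, not modulo lower terms: the factors other than the first two commute
  -- with the transposition.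
  have hJ : H.prod J * T (adjSwap n 0) = H.prod J := by
    obtain ⟨J, ha', rfl⟩ : ∃ K, a ∉ K ∧ J = insert a K :=
      ⟨_, Finset.notMem_erase _ _, (Finset.insert_erase ha).symm⟩
    obtain ⟨J, hb', rfl⟩ : ∃ K, b ∉ K ∧ J = insert b K :=
      ⟨_, Finset.notMem_erase _ _,
        (Finset.insert_erase ((Finset.mem_insert.1 hb).resolve_left hab.symm)).symm⟩
    rw [H.prod_insert ha', H.prod_insert hb', mul_assoc, mul_assoc,
      ← H.swap_mul_prod_of_notMem (i := 0) hn (fun hm => ha' (Finset.mem_insert_of_mem hm)) hb',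
      ← mul_assoc, ← mul_assoc, hc hn, mul_assoc]
  have hsw : w * adjSwap n 0 = Equiv.swap i j * w := by
    rw [adjSwap_of_lt (i := 0) hn, Equiv.mul_swap_eq_swap_mul]
    change Equiv.swap (w a) (w b) * w = _
    rw [hwa, hwb]
  -- Multiply `T w X_J - X_I T w` by `1 - T s₀` and then by `T w⁻¹`: by `hJ` the terms with `X_J`
  -- cancel, leaving `X_I T (i j) - X_I`.
  have h1 := H.perm_mul_prod w J
  have h2 := H.mul_perm_mem_below h1 (adjSwap n 0)
  have h3 := H.mul_perm_mem_below (sub_mem h1 h2) w⁻¹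
  rw [Finset.card_map]
  convert h3 using 1
  simp only [sub_mul, mul_assoc, hJ]
  rw [← map_mul, ← map_mul, ← map_mul, ← mul_assoc w, hsw, mul_assoc (Equiv.swap i j),
    mul_inv_cancel, mul_one, map_one, mul_one]
  abel

/-- Such a permutation is a product of transpositions of elements of `I`, absorbed one at a time. -/
theorem prod_mul_perm (I : Finset (Fin n)) (u : Equiv.Perm (Fin n)) (hu : ∀ i ∉ I, u i = i) :
    H.prod I * T u - H.prod I ∈ H.below I.card := by
  obtain ⟨v, rfl⟩ : ∃ v : Equiv.Perm {i // i ∈ I}, u = Equiv.Perm.ofSubtype v := by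
    refine ⟨u.subtypePerm fun x => ?_, (Equiv.Perm.ofSubtype_subtypePerm _ fun x hx => ?_).symm⟩
    · by_cases hx : x ∈ I
      · simp only [hx, iff_true]
        by_contra h
        exact h ((u.injective (hu _ h)).symm ▸ hx)
      · simp [hu x hx, hx]
    · by_contra h
      exact hx (hu x h)
  clear hu
  induction v using Equiv.Perm.swap_induction_on with
  | one => simp
  | swap_mul v x y hxy ih =>
    have h1 := H.mul_perm_mem_below (H.prod_mul_swap hc (fun e => hxy (Subtype.ext e)) x.2 y.2)
      (Equiv.Perm.ofSubtype v)
    convert add_mem h1 ih using 1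
    rw [map_mul, Equiv.Perm.ofSubtype_swap_eq, map_mul, sub_mul, mul_assoc]
    abel

end Collapse

end IsJucysMurphy

/-! ### The gluing map on the group algebra -/

theorem exists_eq_thick_of_fix {k n : ℕ} (w : Equiv.Perm (Fin k ⊕ Fin n))
    (h : ∀ j, w (Sum.inr j) = Sum.inr j) : ∃ p, w = thick k n p := by
  refine exists_eq_thick w fun x => ?_
  rcases x with a | j
  · rcases hw : w (Sum.inl a) with b | j
    · rfl
    · exact absurd (w.injective (hw.trans (h j).symm)) Sum.inl_ne_inr
  · rw [h]

/-- The thin columns of the edge-count matrix are read from the images of the thin bottom dots; the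
thick column is then forced by the row sums. -/
theorem fuse_eq_of_glue_eq {k n : ℕ} {w v : Equiv.Perm (Fin k ⊕ Fin n)}
    (h : ∀ j, glue k n (w (Sum.inr j)) = glue k n (v (Sum.inr j))) : fuse w = fuse v := by
  refine FusedPerm.ext (funext fun a => Multiset.ext.2 fun b => ?_)
  change (fuseAt w a).count b = (fuseAt v a).count b
  have hs : ∀ j : Fin n, (fuseAt w a).count j.succ = (fuseAt v a).count j.succ := by
    intro j
    rw [count_fuseAt, count_fuseAt]
    refine Fintype.card_congr (Equiv.subtypeEquivRight fun x => ?_)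
    rcases x with x | x
    · simp [glue, (Fin.succ_ne_zero j).symm]
    · rw [Prod.mk.injEq, Prod.mk.injEq, h]
  refine Fin.cases ?_ hs b
  have hc : ∀ u : Equiv.Perm (Fin k ⊕ Fin n), (fuseAt u a).count 0
      + ∑ j : Fin n, (fuseAt u a).count j.succ = pointWeight k n a := by
    intro u
    rw [← Fin.sum_univ_succ fun b => (fuseAt u a).count b,
      Multiset.sum_count_eq_card fun _ _ => Finset.mem_univ _, card_fuseAt]
  have h1 := hc w
  have h2 := hc v
  simp only [hs] at h1
  omega

/-- The version seen from the top: two such permutations differ by a left thick factor, which gluing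
ignores. -/
theorem fuse_eq_of_inv_eq {k n : ℕ} {w v : Equiv.Perm (Fin k ⊕ Fin n)}
    (h : ∀ j, w⁻¹ (Sum.inr j) = v⁻¹ (Sum.inr j)) : fuse w = fuse v := by
  obtain ⟨p, hp⟩ := exists_eq_thick_of_fix (w * v⁻¹) fun j => by
    rw [Equiv.Perm.mul_apply, ← h, ← Equiv.Perm.mul_apply, mul_inv_cancel, Equiv.Perm.one_apply]
  rw [← fuse_thick_mul p v, ← hp, inv_mul_cancel_right]

noncomputable section

namespace FusedAlg

variable {k n : ℕ}

/-- The group algebra of the permutations of `k + n` dots. -/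
abbrev DotAlg (k n : ℕ) : Type := MonoidAlgebra ℂ (Equiv.Perm (Fin k ⊕ Fin n))

/-- The inclusion of the permutations in the group algebra. -/
abbrev dot : Equiv.Perm (Fin k ⊕ Fin n) →* DotAlg k n := MonoidAlgebra.of ℂ _

/-- The linear extension of the gluing map. -/
def glueLin (k n : ℕ) : DotAlg k n →ₗ[ℂ] FusedAlg k n :=
  Finsupp.linearCombination ℂ (fun w => ofDiagram (fuse w)) ∘ₗ
    (MonoidAlgebra.coeffLinearEquiv ℂ).toLinearMap

theorem glueLin_dot (w : Equiv.Perm (Fin k ⊕ Fin n)) : glueLin k n (dot w) = ofDiagram (fuse w) := by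
  simp [glueLin, dot]

theorem glueLin_mul_thick (a : DotAlg k n) (p : Equiv.Perm (Fin k)) :
    glueLin k n (a * dot (thick k n p)) = glueLin k n a := by
  induction a using MonoidAlgebra.induction_on with
  | of w =>
    change glueLin k n (dot w * _) = glueLin k n (dot w)
    rw [← map_mul, glueLin_dot, glueLin_dot, fuse_mul_thick]
  | add a b ha hb => rw [add_mul, map_add, map_add, ha, hb]
  | smul c a ha => rw [smul_mul_assoc, map_smul, map_smul, ha]

theorem glueLin_mul_glueLin (a b : DotAlg k n) : glueLin k n a * glueLin k n b
    = (k.factorial : ℂ)⁻¹ • ∑ p, glueLin k n (a * dot (thick k n p) * b) := by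
  induction a using MonoidAlgebra.induction_on with
  | of w =>
    induction b using MonoidAlgebra.induction_on with
    | of v =>
      change glueLin k n (dot w) * glueLin k n (dot v)
        = (k.factorial : ℂ)⁻¹ • ∑ p, glueLin k n (dot w * _ * dot v)
      simp only [← map_mul, glueLin_dot, ofDiagram_fuse_mul]
    | add a b ha hb => simp only [mul_add, map_add, ha, hb, Finset.sum_add_distrib, smul_add]
    | smul c a ha =>
      simp only [mul_smul_comm, map_smul, ha, ← Finset.smul_sum]
      rw [smul_comm]
  | add a b ha hb => simp only [add_mul, map_add, ha, hb, Finset.sum_add_distrib, smul_add]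
  | smul c a ha =>
    simp only [smul_mul_assoc, map_smul, ha, ← Finset.smul_sum]
    rw [smul_comm]

/-- The centralizer of the permutations of the `k` first dots. -/
def thickCentralizer (k n : ℕ) : Subalgebra ℂ (DotAlg k n) :=
  Subalgebra.centralizer ℂ (Set.range fun p => dot (thick k n p))

theorem mem_thickCentralizer {a : DotAlg k n} : a ∈ thickCentralizer k n ↔
    ∀ p, dot (thick k n p) * a = a * dot (thick k n p) := by
  rw [thickCentralizer, Subalgebra.mem_centralizer_iff]
  exact Set.forall_mem_range

/-- Each connecting permutation in the average can be moved past `b` to the far right, where gluing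
erases it; all `k!` terms become equal. -/
theorem glueLin_mul (a : DotAlg k n) {b : DotAlg k n} (hb : b ∈ thickCentralizer k n) :
    glueLin k n (a * b) = glueLin k n a * glueLin k n b := by
  rw [glueLin_mul_glueLin]
  simp only [mul_assoc, mem_thickCentralizer.1 hb]
  simp only [← mul_assoc, glueLin_mul_thick, factorial_inv_smul_sum]

/-- The gluing map is a morphism of algebras on the centralizer. -/
def glueHom (k n : ℕ) : thickCentralizer k n →ₐ[ℂ] FusedAlg k n :=
  AlgHom.ofLinearMap (glueLin k n ∘ₗ (thickCentralizer k n).val.toLinearMap)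
    (by
      change glueLin k n 1 = 1
      rw [← map_one dot, glueLin_dot, one_def])
    (fun a b => glueLin_mul a.1 b.2)

/-! ### Jucys–Murphy elements -/

theorem dot_mul_sum_swap (g : Equiv.Perm (Fin k ⊕ Fin n)) (s : Finset (Fin k ⊕ Fin n))
    (y : Fin k ⊕ Fin n) : dot g * ∑ b ∈ s, dot (Equiv.swap b y)
      = (∑ b ∈ s.map g.toEmbedding, dot (Equiv.swap b (g y))) * dot g := by
  rw [Finset.mul_sum, Finset.sum_mul, Finset.sum_map]
  refine Finset.sum_congr rfl fun b _ => ?_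
  rw [← map_mul, Equiv.mul_swap_eq_swap_mul, map_mul]
  rfl

theorem dot_mul_sum_swap_of_fix {g : Equiv.Perm (Fin k ⊕ Fin n)} {s : Finset (Fin k ⊕ Fin n)}
    {y : Fin k ⊕ Fin n} (hs : ∀ b ∈ s, g b ∈ s) (hy : g y = y) :
    dot g * ∑ b ∈ s, dot (Equiv.swap b y) = (∑ b ∈ s, dot (Equiv.swap b y)) * dot g := by
  rw [dot_mul_sum_swap, hy]
  congr 2
  refine Finset.eq_of_subset_of_card_le (fun x hx => ?_) (by rw [Finset.card_map])
  obtain ⟨b, hb, rfl⟩ := Finset.mem_map.1 hx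
  exact hs b hb

theorem sum_swap_mem_thickCentralizer {s : Finset (Fin n)} (j : Fin n) :
    ∑ b ∈ (Finset.univ : Finset (Fin k)).disjSum s, dot (Equiv.swap b (Sum.inr j))
      ∈ thickCentralizer k n := by
  refine mem_thickCentralizer.2 fun p => dot_mul_sum_swap_of_fix ?_ rfl
  rintro (a | i) hi
  · exact Finset.inl_mem_disjSum.2 (Finset.mem_univ _)
  · exact hi

/-- The dots before the thin dot `r`. -/
def lowerDots (k : ℕ) (r : Fin n) : Finset (Fin k ⊕ Fin n) :=
  (Finset.univ : Finset (Fin k)).disjSum (Finset.Iio r)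

theorem inl_mem_lowerDots (r : Fin n) (a : Fin k) : Sum.inl a ∈ lowerDots k r :=
  Finset.inl_mem_disjSum.2 (Finset.mem_univ a)

theorem inr_mem_lowerDots {r i : Fin n} : Sum.inr i ∈ lowerDots k r ↔ i < r :=
  Finset.inr_mem_disjSum.trans Finset.mem_Iio

/-- The Jucys–Murphy element of the thin dot `r`. -/
def jm (k : ℕ) (r : Fin n) : DotAlg k n := ∑ b ∈ lowerDots k r, dot (Equiv.swap b (Sum.inr r))

theorem jm_mem_thickCentralizer (r : Fin n) : jm k r ∈ thickCentralizer k n :=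
  sum_swap_mem_thickCentralizer r

theorem dot_swap_mul_jm (i j r : Fin n) (hj : j ≠ r) (hi : i ≠ r) (h : i < r ↔ j < r) :
    dot (Equiv.swap (Sum.inr i) (Sum.inr j)) * jm k r
      = jm k r * dot (Equiv.swap (Sum.inr i) (Sum.inr j)) := by
  refine dot_mul_sum_swap_of_fix (fun b hb => ?_) ?_
  · rw [Equiv.swap_apply_def]
    split_ifs with h1 h2
    · subst h1; rw [inr_mem_lowerDots] at hb ⊢; exact h.1 hb
    · subst h2; rw [inr_mem_lowerDots] at hb ⊢; exact h.2 hb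
    · exact hb
  · rw [Equiv.swap_apply_of_ne_of_ne] <;> simp [hi.symm, hj.symm]

theorem jm_mul_jm_of_lt {r u : Fin n} (h : r < u) : jm k r * jm k u = jm k u * jm k r := by
  conv_lhs => rw [jm, Finset.sum_mul]
  conv_rhs => rw [jm.eq_def k r, Finset.mul_sum]
  refine Finset.sum_congr rfl fun b hb => dot_mul_sum_swap_of_fix (fun x hx => ?_) ?_
  · have hb' : b ∈ lowerDots k u := by
      rcases b with a | i
      · exact inl_mem_lowerDots _ _
      · exact inr_mem_lowerDots.2 ((inr_mem_lowerDots.1 hb).trans h)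
    rw [Equiv.swap_apply_def]
    split_ifs
    · exact inr_mem_lowerDots.2 h
    · exact hb'
    · exact hx
  · rw [Equiv.swap_apply_of_ne_of_ne]
    · rintro rfl
      exact (inr_mem_lowerDots.1 hb).asymm h
    · simp [h.ne']

theorem jm_mul_jm (r u : Fin n) : jm k r * jm k u = jm k u * jm k r := by
  rcases lt_trichotomy r u with h | rfl | h
  exacts [jm_mul_jm_of_lt h, rfl, (jm_mul_jm_of_lt h).symm]

theorem dot_swap_mul_jm_succ (r : ℕ) (h : r + 1 < n) :
    dot (Equiv.swap (Sum.inr ⟨r, by omega⟩) (Sum.inr ⟨r + 1, h⟩)) * jm k ⟨r, by omega⟩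
      * dot (Equiv.swap (Sum.inr ⟨r, by omega⟩) (Sum.inr ⟨r + 1, h⟩))
      + dot (Equiv.swap (Sum.inr ⟨r, by omega⟩) (Sum.inr ⟨r + 1, h⟩)) = jm k ⟨r + 1, h⟩ := by
  rw [jm, dot_mul_sum_swap, mul_assoc, ← map_mul, Equiv.swap_mul_self, map_one, mul_one,
    Equiv.swap_apply_left]
  have hlow : lowerDots k (⟨r + 1, h⟩ : Fin n) = insert (Sum.inr ⟨r, by omega⟩)
      ((lowerDots k (⟨r, by omega⟩ : Fin n)).map
        (Equiv.swap (Sum.inr ⟨r, by omega⟩) (Sum.inr ⟨r + 1, h⟩)).toEmbedding) := by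
    have : (lowerDots k (⟨r, by omega⟩ : Fin n)).map
        (Equiv.swap (Sum.inr ⟨r, by omega⟩) (Sum.inr ⟨r + 1, h⟩)).toEmbedding
        = lowerDots k (⟨r, by omega⟩ : Fin n) := by
      rw [Finset.map_eq_image]
      refine (Finset.image_congr fun x hx => ?_).trans Finset.image_id
      refine Equiv.swap_apply_of_ne_of_ne ?_ ?_
      · rintro rfl
        exact lt_irrefl _ (inr_mem_lowerDots.1 hx)
      · rintro rfl
        have := inr_mem_lowerDots.1 hx
        rw [Fin.lt_def] at this
        simp only at this
        omega
    rw [this]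
    ext x
    rw [Finset.mem_insert]
    rcases x with a | i
    · simp [inl_mem_lowerDots]
    · rw [inr_mem_lowerDots, inr_mem_lowerDots, Sum.inr.injEq, Fin.lt_def, Fin.lt_def, Fin.ext_iff]
      simp only
      omega
  rw [jm, hlow, Finset.sum_insert, add_comm]
  intro hm
  obtain ⟨x, hx, e⟩ := Finset.mem_map.1 hm
  rw [Equiv.coe_toEmbedding, Equiv.swap_apply_eq_iff, Equiv.swap_apply_left] at e
  subst e
  have := inr_mem_lowerDots.1 hx
  rw [Fin.lt_def] at this
  simp only at this
  omega

theorem dot_thin_mem_thickCentralizer (q : Equiv.Perm (Fin n)) :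
    dot (Equiv.sumCongr (Equiv.refl (Fin k)) q) ∈ thickCentralizer k n := by
  refine mem_thickCentralizer.2 fun p => ?_
  rw [← map_mul, ← map_mul]
  congr 1
  ext x
  rcases x with x | x <;> rfl

theorem swap_inr (i j : Fin n) : Equiv.swap (Sum.inr i : Fin k ⊕ Fin n) (Sum.inr j)
    = Equiv.sumCongr (Equiv.refl (Fin k)) (Equiv.swap i j) :=
  (Equiv.Perm.sumCongr_refl_swap i j).symm

theorem dot_swap_inr_mem (i j : Fin n) :
    dot (Equiv.swap (Sum.inr i) (Sum.inr j)) ∈ thickCentralizer k n := by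
  rw [swap_inr]
  exact dot_thin_mem_thickCentralizer _

/-! ### The morphism from the Hecke algebra -/

/-- The images of the generators in the group algebra. -/
def genImage (k : ℕ) : HeckeGen n → thickCentralizer k n
  | HeckeGen.x r => ⟨1 + jm k r, add_mem (one_mem _) (jm_mem_thickCentralizer r)⟩
  | HeckeGen.s i => ⟨dot (Equiv.swap (Sum.inr ⟨i, by omega⟩) (Sum.inr ⟨i + 1, by omega⟩)),
      dot_swap_inr_mem _ _⟩

theorem glueLin_dot_swap (a : Fin k) (h0 : 0 < k) (hn : 0 < n) :
    glueLin k n (dot (Equiv.swap (Sum.inl a) (Sum.inr ⟨0, hn⟩))) = sigmaZero k n h0 hn := by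
  rw [glueLin_dot, sigmaZero]
  congr 1
  refine fuse_eq_of_glue_eq fun j => ?_
  by_cases hj : j = ⟨0, hn⟩
  · subst hj
    rw [Equiv.swap_apply_right, Equiv.swap_apply_right]
    rfl
  · rw [Equiv.swap_apply_of_ne_of_ne, Equiv.swap_apply_of_ne_of_ne] <;> simp [hj]

theorem lowerDots_zero (hn : 0 < n) : lowerDots k (⟨0, hn⟩ : Fin n)
    = (Finset.univ : Finset (Fin k)).map ⟨Sum.inl, Sum.inl_injective⟩ := by
  ext x
  rcases x with a | i
  · simp [inl_mem_lowerDots]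
  · rw [inr_mem_lowerDots, Fin.lt_def]; simp

theorem jm_zero (hn : 0 < n) :
    jm k (⟨0, hn⟩ : Fin n) = ∑ a : Fin k, dot (Equiv.swap (Sum.inl a) (Sum.inr ⟨0, hn⟩)) := by
  rw [jm, lowerDots_zero, Finset.sum_map]
  rfl

theorem glueLin_jm_zero (h0 : 0 < k) (hn : 0 < n) :
    glueLin k n (jm k ⟨0, hn⟩) = (k : ℂ) • sigmaZero k n h0 hn := by
  rw [jm_zero, map_sum]
  simp only [glueLin_dot_swap _ h0 hn]
  rw [Finset.sum_const, Finset.card_univ, Fintype.card_fin, Nat.cast_smul_eq_nsmul]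

/-- In the double sum, the `k` diagonal terms are the identity, and each of the `k (k - 1)` others
glues to `σ₀`. Thus `(J - k)(J + 1) = 0` for the glued `J`, and the shift by `1` moves the roots to
`k + 1` and `0`. -/
theorem glueLin_jm_zero_sq (h0 : 0 < k) (hn : 0 < n) :
    glueLin k n (jm k ⟨0, hn⟩ * jm k ⟨0, hn⟩)
      = (k : ℂ) • 1 + ((k : ℂ) - 1) • glueLin k n (jm k ⟨0, hn⟩) := by
  have key : ∀ a b : Fin k, glueLin k n (dot (Equiv.swap (Sum.inl a) (Sum.inr ⟨0, hn⟩))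
      * dot (Equiv.swap (Sum.inl b) (Sum.inr ⟨0, hn⟩)))
      = sigmaZero k n h0 hn + if a = b then 1 - sigmaZero k n h0 hn else 0 := by
    intro a b
    split_ifs with hab
    · subst hab
      rw [← map_mul, Equiv.swap_mul_self, glueLin_dot, one_def]
      abel
    · rw [add_zero, ← glueLin_dot_swap a h0 hn, ← map_mul, glueLin_dot, glueLin_dot]
      congr 1
      refine fuse_eq_of_glue_eq fun j => ?_
      rw [Equiv.Perm.mul_apply]
      by_cases hj : j = ⟨0, hn⟩
      · subst hj
        rw [Equiv.swap_apply_right, Equiv.swap_apply_right, Equiv.swap_apply_of_ne_of_ne]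
        · rfl
        · simpa using Ne.symm hab
        · simp
      · rw [Equiv.swap_apply_of_ne_of_ne (x := (Sum.inr j : Fin k ⊕ Fin n)) (a := Sum.inl b)
          (b := Sum.inr ⟨0, hn⟩) (by simp) (by simpa using hj)]
  rw [glueLin_jm_zero h0 hn]
  rw [jm_zero, Finset.sum_mul, map_sum]
  simp only [Finset.mul_sum, map_sum, key, Finset.sum_add_distrib, Finset.sum_ite_eq,
    Finset.mem_univ, if_true, Finset.sum_const, Finset.card_univ, Fintype.card_fin,
    ← Nat.cast_smul_eq_nsmul ℂ]
  module

/-- The morphism `x_r ↦ 1 + jm r`, `s_i ↦ σ_i`. -/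
def phi (k n : ℕ) (hk : 0 < k) : Hecke ![0, (k : ℂ) + 1] n →ₐ[ℂ] FusedAlg k n :=
  RingQuot.liftAlgHom ℂ ⟨(glueHom k n).comp (FreeAlgebra.lift ℂ (genImage k)), by
    have hx : ∀ r : Fin n, FreeAlgebra.lift ℂ (genImage k) (freeX r) = genImage k (.x r) :=
      fun r => FreeAlgebra.lift_ι_apply _ _
    have hs : ∀ i : Fin (n - 1), FreeAlgebra.lift ℂ (genImage k) (freeS i) = genImage k (.s i) :=
      fun i => FreeAlgebra.lift_ι_apply _ _
    intro a b hab
    simp only [AlgHom.comp_apply]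
    cases hab with
    -- The only relation that needs gluing; all the others are checked inside the centralizer.
    | cyclotomic h0 =>
      simp only [map_mul, map_sub, map_zero, hx, AlgHom.commutes, Matrix.cons_val_zero,
        Matrix.cons_val_one]
      have hX : glueHom k n (genImage k (.x ⟨0, h0⟩)) = 1 + glueLin k n (jm k ⟨0, h0⟩) := by
        rw [← map_one (glueHom k n)]
        exact map_add (glueLin k n) 1 (jm k ⟨0, h0⟩)
      have hJ := glueLin_jm_zero_sq hk h0
      rw [glueLin_mul _ (jm_mem_thickCentralizer _)] at hJ
      rw [hX, Algebra.algebraMap_eq_smul_one]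
      simp only [add_mul, mul_add, mul_sub, one_mul, mul_one, sub_zero, mul_smul_comm, hJ]
      module
    | x_s r l h₁ h₂ =>
      congr 1
      simp only [map_mul, hx, hs]
      refine Subtype.ext ?_
      change (1 + jm k r) * dot _ = dot _ * (1 + jm k r)
      rw [add_mul, mul_add, dot_swap_mul_jm, one_mul, mul_one]
      · exact fun e => h₂ (Fin.ext_iff.1 e).symm
      · exact fun e => h₁ (Fin.ext_iff.1 e).symm
      · rw [Fin.lt_def, Fin.lt_def]; simp only; omega
    | x_x r u =>
      congr 1
      simp only [map_mul, hx]
      refine Subtype.ext ?_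
      change (1 + jm k r) * (1 + jm k u) = (1 + jm k u) * (1 + jm k r)
      simp only [add_mul, mul_add, one_mul, mul_one, jm_mul_jm r u]
      abel
    | x_succ r hr =>
      congr 1
      simp only [map_mul, map_add, hx, hs]
      refine Subtype.ext ?_
      change 1 + jm k _ = dot _ * (1 + jm k _) * dot _ + dot _
      rw [mul_add, mul_one, add_mul, ← map_mul, Equiv.swap_mul_self, map_one, add_assoc,
        dot_swap_mul_jm_succ r (by omega)]
    | s_sq i =>
      congr 1
      simp only [map_mul, map_one, hs]
      refine Subtype.ext ?_
      change dot _ * dot _ = 1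
      rw [← map_mul, Equiv.swap_mul_self, map_one]
    | s_comm i j hij =>
      congr 1
      simp only [map_mul, hs]
      refine Subtype.ext ?_
      change dot _ * dot _ = dot _ * dot _
      rw [← map_mul, ← map_mul, Equiv.mul_swap_eq_swap_mul, Equiv.swap_apply_of_ne_of_ne,
        Equiv.swap_apply_of_ne_of_ne] <;> simp <;> omega
    | braid i hi =>
      congr 1
      simp only [map_mul, hs]
      refine Subtype.ext ?_
      change dot _ * dot _ * dot _ = dot _ * dot _ * dot _
      simp only [← map_mul]
      congr 1
      apply swap_braid <;> (simp; try omega)⟩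

end FusedAlg
end

/-! ### Values of the morphism on the generators, and the relation `x₁ x₂ (1 - s₁) = 0` for diagrams
-/

noncomputable section

namespace FusedAlg

variable {k n : ℕ}

theorem phi_x (hk : 0 < k) (r : Fin n) : phi k n hk (Hecke.x r) = glueLin k n (1 + jm k r) := by
  refine (RingQuot.liftAlgHom_mkAlgHom_apply ℂ _ _ _).trans ?_
  rw [AlgHom.comp_apply, freeX, FreeAlgebra.lift_ι_apply]
  rfl

theorem phi_s (hk : 0 < k) (i : Fin (n - 1)) : phi k n hk (Hecke.s i)
    = glueLin k n (dot (Equiv.swap (Sum.inr ⟨i, by omega⟩) (Sum.inr ⟨i + 1, by omega⟩))) := by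
  refine (RingQuot.liftAlgHom_mkAlgHom_apply ℂ _ _ _).trans ?_
  rw [AlgHom.comp_apply, freeS, FreeAlgebra.lift_ι_apply]
  rfl

theorem phi_s_eq_sigma (hk : 0 < k) (i : Fin (n - 1)) :
    phi k n hk (Hecke.s i) = sigma k n i := by
  rw [phi_s, glueLin_dot]
  rfl

theorem phi_x_zero (hk : 0 < k) (hn : 0 < n) :
    phi k n hk (Hecke.x ⟨0, hn⟩) = t k n hk hn := by
  rw [phi_x, map_add, glueLin_jm_zero hk hn, ← map_one dot, glueLin_dot, t, one_def]

/-- The unit is the degenerate transposition of the thin dot with itself, which makes the sum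
uniform over a larger set of dots. -/
theorem one_add_jm (r : Fin n) :
    1 + jm k r = ∑ b ∈ insert (Sum.inr r) (lowerDots k r), dot (Equiv.swap b (Sum.inr r)) := by
  rw [Finset.sum_insert (by rw [inr_mem_lowerDots]; exact lt_irrefl r), Equiv.swap_self]
  rfl

theorem swap_apply_mem_finset {α : Type*} [DecidableEq α] {s : Finset α} {a b c : α} (ha : a ∈ s)
    (hb : b ∈ s) (hc : c ∈ s) : Equiv.swap a b c ∈ s := by
  rw [Equiv.swap_apply_def]
  split_ifs
  exacts [hb, ha, hc]

/-- With `E` the thick dots together with `y` and `z`, the product is the sum of `(c y)(d z)` over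
`c ∈ E \ {z}` and `d ∈ E`. After gluing, a term depends only on the preimages of the thin top dots.
Those of `y` and `z` run over all ordered pairs of distinct elements of `E`, a set stable under the
exchange of `y` and `z`. -/
theorem glueLin_mul_swap (h : 1 < n) :
    glueLin k n ((1 + jm k ⟨0, by omega⟩) * (1 + jm k ⟨1, h⟩)
      * dot (Equiv.swap (Sum.inr ⟨0, by omega⟩) (Sum.inr ⟨1, h⟩)))
      = glueLin k n ((1 + jm k ⟨0, by omega⟩) * (1 + jm k ⟨1, h⟩)) := by
  let y : Fin k ⊕ Fin n := Sum.inr ⟨0, by omega⟩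
  let z : Fin k ⊕ Fin n := Sum.inr ⟨1, h⟩
  let E : Finset (Fin k ⊕ Fin n) := insert z (lowerDots k ⟨1, h⟩)
  have hyz : y ≠ z := by simp [y, z]
  have hE : ∀ j : Fin n, Sum.inr j ∈ E ↔ (j : ℕ) ≤ 1 := by
    intro j
    rw [Finset.mem_insert, inr_mem_lowerDots, Sum.inr.injEq, Fin.ext_iff, Fin.lt_def]
    simp only
    omega
  have hyE : y ∈ E := (hE _).2 (by simp)
  have hzE : z ∈ E := (hE _).2 (by simp)
  have hC : insert y (lowerDots k ⟨0, by omega⟩) = E.erase z := by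
    ext x
    rw [Finset.mem_erase, Finset.mem_insert]
    rcases x with a | j
    · simp [inl_mem_lowerDots, E, z]
    · rw [hE, inr_mem_lowerDots, Sum.inr.injEq, Fin.ext_iff, Fin.lt_def, Ne, Sum.inr.injEq,
        Fin.ext_iff]
      simp only
      omega
  rw [one_add_jm, one_add_jm, Finset.sum_mul_sum, Finset.sum_mul]
  change glueLin k n (∑ c ∈ insert y (lowerDots k ⟨0, by omega⟩),
      (∑ d ∈ E, dot (Equiv.swap c y) * dot (Equiv.swap d z)) * dot (Equiv.swap y z))
    = glueLin k n (∑ c ∈ insert y (lowerDots k ⟨0, by omega⟩),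
      ∑ d ∈ E, dot (Equiv.swap c y) * dot (Equiv.swap d z))
  simp only [hC, Finset.sum_mul, map_sum, ← map_mul, glueLin_dot]
  rw [← Finset.sum_product', ← Finset.sum_product']
  let s := Equiv.swap y z
  -- In `(c y)(d z)` the preimage of `z` is `d` and that of `y` is `(d z) c`. Right multiplication
  -- by `s` applies `s` to both; `f` expresses this in the parameters `(c, d)`.
  let f : (Fin k ⊕ Fin n) × (Fin k ⊕ Fin n) → (Fin k ⊕ Fin n) × (Fin k ⊕ Fin n) := fun p =>
    (Equiv.swap (s p.2) z (s (Equiv.swap p.2 z p.1)), s p.2)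
  have hs : ∀ x ∈ E, s x ∈ E := fun x hx => swap_apply_mem_finset hyE hzE hx
  have hfm : ∀ p ∈ E.erase z ×ˢ E, f p ∈ E.erase z ×ˢ E := by
    rintro ⟨c, d⟩ hp
    obtain ⟨hc, hd⟩ := Finset.mem_product.1 hp
    obtain ⟨hcz, hc⟩ := Finset.mem_erase.1 hc
    refine Finset.mem_product.2 ⟨Finset.mem_erase.2 ⟨fun e => hcz ?_, ?_⟩, hs _ hd⟩
    · simp only [f] at e
      rw [Equiv.swap_apply_eq_iff, Equiv.swap_apply_right] at e
      have e' := s.injective e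
      rwa [Equiv.swap_apply_eq_iff, Equiv.swap_apply_left] at e'
    · exact swap_apply_mem_finset (hs _ hd) hzE (hs _ (swap_apply_mem_finset hd hzE hc))
  have hff : ∀ p, f (f p) = p := by
    rintro ⟨c, d⟩
    simp [f, s]
  refine Finset.sum_nbij' f f hfm hfm (fun p _ => hff p) (fun p _ => hff p) ?_
  rintro ⟨c, d⟩ hp
  have hp' := hfm _ hp
  obtain ⟨hc, hd⟩ := Finset.mem_product.1 hp
  obtain ⟨hcz, hc⟩ := Finset.mem_erase.1 hc
  obtain ⟨hc', hd'⟩ := Finset.mem_product.1 hp'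
  obtain ⟨hcz', hc'⟩ := Finset.mem_erase.1 hc'
  congr 1
  refine fuse_eq_of_inv_eq fun j => ?_
  simp only [mul_inv_rev, Equiv.swap_inv, Equiv.Perm.mul_apply]
  by_cases hj : (j : ℕ) ≤ 1
  · obtain hj | hj : (j : ℕ) = 0 ∨ (j : ℕ) = 1 := by omega
    · rw [show j = ⟨0, by omega⟩ from Fin.ext hj]
      change s (Equiv.swap d z (Equiv.swap c y y))
        = Equiv.swap (f (c, d)).2 z (Equiv.swap (f (c, d)).1 y y)
      rw [Equiv.swap_apply_right, Equiv.swap_apply_right, Equiv.swap_apply_self]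
    · rw [show j = ⟨1, h⟩ from Fin.ext hj]
      change s (Equiv.swap d z (Equiv.swap c y z))
        = Equiv.swap (f (c, d)).2 z (Equiv.swap (f (c, d)).1 y z)
      rw [Equiv.swap_apply_of_ne_of_ne (Ne.symm hcz) hyz.symm,
        Equiv.swap_apply_of_ne_of_ne (Ne.symm hcz') hyz.symm, Equiv.swap_apply_right,
        Equiv.swap_apply_right]
  · have hne : ∀ x ∈ E, (Sum.inr j : Fin k ⊕ Fin n) ≠ x := by
      rintro x hx rfl
      exact hj ((hE j).1 hx)
    have hfix : ∀ x ∈ E, ∀ x' ∈ E, Equiv.swap x x' (Sum.inr j) = Sum.inr j := fun x hx x' hx' =>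
      Equiv.swap_apply_of_ne_of_ne (hne x hx) (hne x' hx')
    rw [hfix c hc y hyE, hfix d hd z hzE, hfix y hyE z hzE, hfix _ hc' y hyE, hfix _ hd' z hzE]

theorem phi_collapse (hk : 0 < k) (h : 1 < n) :
    phi k n hk (Hecke.x ⟨0, by omega⟩ * Hecke.x ⟨1, h⟩ * Hecke.s ⟨0, by omega⟩)
      = phi k n hk (Hecke.x ⟨0, by omega⟩ * Hecke.x ⟨1, h⟩) := by
  rw [map_mul, map_mul, phi_x, phi_x, phi_s, ← glueLin_mul, ← glueLin_mul]
  · exact glueLin_mul_swap h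
  · exact dot_swap_inr_mem _ _
  · exact add_mem (one_mem _) (jm_mem_thickCentralizer _)

/-! ### Surjectivity -/

theorem glueLin_thin_mem_range (hk : 0 < k) (q : Equiv.Perm (Fin n)) :
    glueLin k n (dot (Equiv.sumCongr (Equiv.refl (Fin k)) q)) ∈ (phi k n hk).range := by
  induction q using adjSwap_induction with
  | h1 =>
    have : (Equiv.sumCongr (Equiv.refl (Fin k)) (1 : Equiv.Perm (Fin n))) = 1 :=
      Equiv.Perm.sumCongr_one
    rw [this, glueLin_dot]
    exact one_mem _
  | hmul i hi q ih =>
    have : Equiv.sumCongr (Equiv.refl (Fin k)) (adjSwap n i * q)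
        = Equiv.sumCongr (Equiv.refl (Fin k)) (adjSwap n i)
          * Equiv.sumCongr (Equiv.refl (Fin k)) q :=
      ((Equiv.Perm.sumCongr_mul _ _ _ _).trans (by rfl)).symm
    rw [this, map_mul, glueLin_mul _ (dot_thin_mem_thickCentralizer q)]
    refine mul_mem ?_ ih
    rw [adjSwap_of_lt (by omega), ← swap_inr]
    exact ⟨_, phi_s hk ⟨i, hi⟩⟩

/-- The number of edges from the thin bottom dots to the thick top dots. -/
def mixedCard (w : Equiv.Perm (Fin k ⊕ Fin n)) : ℕ :=
  (Finset.univ.filter fun j : Fin n => (w (Sum.inr j)).isLeft).card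

theorem sum_swap_inl (j : Fin n) : ∑ a : Fin k, dot (Equiv.swap (Sum.inl a) (Sum.inr j))
    = ∑ b ∈ (Finset.univ : Finset (Fin k)).disjSum ∅, dot (Equiv.swap b (Sum.inr j)) := by
  rw [Finset.sum_disjSum, Finset.sum_empty, add_zero]

/-- This is the Jucys–Murphy element with its transpositions of thin dots removed. -/
theorem glueLin_sum_swap_mem_range (hk : 0 < k) (j : Fin n) :
    glueLin k n (∑ a : Fin k, dot (Equiv.swap (Sum.inl a) (Sum.inr j))) ∈ (phi k n hk).range := by
  have h : ∑ a : Fin k, dot (Equiv.swap (Sum.inl a) (Sum.inr j))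
      = (1 + jm k j) - 1 - ∑ i ∈ Finset.Iio j, dot (Equiv.swap (Sum.inr i) (Sum.inr j)) := by
    rw [jm, lowerDots, Finset.sum_disjSum]
    abel
  rw [h, map_sub, map_sub, map_sum]
  refine sub_mem (sub_mem ⟨_, phi_x hk j⟩ ?_) (sum_mem fun i _ => ?_)
  · rw [← map_one dot, glueLin_dot]
    exact one_mem _
  · rw [swap_inr]
    exact glueLin_thin_mem_range hk _

/-- Otherwise the thick dots would already fill the thick top point, leaving no room for the edge
from `j`. -/
theorem exists_isRight (w : Equiv.Perm (Fin k ⊕ Fin n)) {j : Fin n}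
    (hj : (w (Sum.inr j)).isLeft) : ∃ a, (w (Sum.inl a)).isRight := by
  by_contra! h
  have h' : ∀ a, ∃ b, w (Sum.inl a) = Sum.inl b := fun a => by
    have := h a
    rcases hw : w (Sum.inl a) with b | b
    · exact ⟨b, rfl⟩
    · simp [hw] at this
  choose f hf using h'
  have hinj : Function.Injective f := fun a b e =>
    Sum.inl_injective (w.injective ((hf a).trans (e ▸ (hf b).symm)))
  obtain ⟨b, hb⟩ := Sum.isLeft_iff.1 hj
  obtain ⟨a, ha⟩ := (Finite.surjective_of_injective hinj) b
  exact Sum.inl_ne_inr (w.injective ((hf a).trans (by rw [ha, hb])))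

/-- A diagram with a mixed edge is recovered from the product of a diagram with one mixed edge fewer
and `∑ₐ (a j)`. The terms of this product are copies of the wanted diagram and diagrams with fewer
mixed edges; division by the multiplicity is possible over `ℂ`. -/
theorem ofDiagram_fuse_mem_range (hk : 0 < k) (m : ℕ) : ∀ w : Equiv.Perm (Fin k ⊕ Fin n),
    mixedCard w = m → ofDiagram (fuse w) ∈ (phi k n hk).range := by
  induction m with
  | zero =>
    intro w hw
    rw [mixedCard, Finset.card_eq_zero, Finset.filter_eq_empty_iff] at hw
    have h' : ∀ j, ∃ i, w (Sum.inr j) = Sum.inr i := fun j => by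
      have := hw (Finset.mem_univ j)
      rcases hj : w (Sum.inr j) with b | b
      · simp [hj] at this
      · exact ⟨b, rfl⟩
    choose f hf using h'
    have hinj : Function.Injective f := fun a b e =>
      Sum.inr_injective (w.injective ((hf a).trans (e ▸ (hf b).symm)))
    have e : fuse w = fuse (Equiv.sumCongr (Equiv.refl (Fin k))
        (Equiv.ofBijective f (Finite.injective_iff_bijective.1 hinj))) :=
      fuse_eq_of_glue_eq fun j => by rw [hf]; rfl
    rw [e, ← glueLin_dot]
    exact glueLin_thin_mem_range hk _
  | succ m ih =>
    intro w hw
    obtain ⟨j, hj⟩ : ∃ j, (w (Sum.inr j)).isLeft := by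
      obtain ⟨j, hj⟩ := Finset.card_pos.1 (show 0 < mixedCard w from hw ▸ Nat.succ_pos m)
      exact ⟨j, (Finset.mem_filter.1 hj).2⟩
    obtain ⟨a₀, ha₀⟩ := exists_isRight w hj
    -- Exchanging the mixed edge from `j` with an edge from the thick bottom point to a thin top dot
    -- removes one mixed edge.
    let v := w * Equiv.swap (Sum.inl a₀) (Sum.inr j)
    have hvj : v (Sum.inr j) = w (Sum.inl a₀) := by
      simp [v, Equiv.Perm.mul_apply]
    have hva : v (Sum.inl a₀) = w (Sum.inr j) := by
      simp [v, Equiv.Perm.mul_apply]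
    have hvi : ∀ i, i ≠ j → v (Sum.inr i) = w (Sum.inr i) := by
      intro i hi
      rw [Equiv.Perm.mul_apply, Equiv.swap_apply_of_ne_of_ne] <;> simp [hi]
    have hright : ∀ u : Equiv.Perm (Fin k ⊕ Fin n), (u (Sum.inr j)).isRight →
        (∀ i, i ≠ j → u (Sum.inr i) = w (Sum.inr i)) → mixedCard u = m := by
      intro u hu hu'
      have : (Finset.univ.filter fun i : Fin n => (u (Sum.inr i)).isLeft)
          = (Finset.univ.filter fun i : Fin n => (w (Sum.inr i)).isLeft).erase j := by
        ext i
        rw [Finset.mem_erase, Finset.mem_filter, Finset.mem_filter]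
        by_cases hi : i = j
        · subst hi
          simpa using hu
        · simp [hi, hu' i hi]
      rw [mixedCard, this, Finset.card_erase_of_mem (by simpa using hj)]
      exact Nat.sub_eq_of_eq_add hw
    have hvm : ofDiagram (fuse v) ∈ (phi k n hk).range := ih v (hright v (hvj ▸ ha₀) hvi)
    have hvai : ∀ a i, i ≠ j →
        (v * Equiv.swap (Sum.inl a) (Sum.inr j) : Equiv.Perm _) (Sum.inr i) = w (Sum.inr i) := by
      intro a i hi
      rw [Equiv.Perm.mul_apply, Equiv.swap_apply_of_ne_of_ne, hvi i hi] <;> simp [hi]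
    have hsum : glueLin k n (dot v * ∑ a : Fin k, dot (Equiv.swap (Sum.inl a) (Sum.inr j)))
        ∈ (phi k n hk).range := by
      rw [glueLin_mul, glueLin_dot]
      · exact mul_mem hvm (glueLin_sum_swap_mem_range hk j)
      · rw [sum_swap_inl]
        exact sum_swap_mem_thickCentralizer j
    -- If `v` sends `a` to a thick dot, the term glues to the diagram of `w`; otherwise `j` is again
    -- sent to a thin dot and the induction hypothesis applies. The first kind is nonempty since it
    -- contains `a₀`.
    rw [Finset.mul_sum, map_sum, ← Finset.sum_filter_add_sum_filter_not _
      fun a => (v (Sum.inl a)).isLeft] at hsum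
    simp only [← map_mul, glueLin_dot] at hsum
    have h1 := (add_mem_cancel_right (sum_mem fun a ha => ?_)).1 hsum
    · rw [Finset.sum_congr rfl (g := fun _ => ofDiagram (fuse w)), Finset.sum_const,
        ← Nat.cast_smul_eq_nsmul ℂ] at h1
      · have hne : ((Finset.univ.filter fun a => (v (Sum.inl a)).isLeft).card : ℂ) ≠ 0 :=
          Nat.cast_ne_zero.2 (Finset.card_ne_zero_of_mem
            (Finset.mem_filter.2 ⟨Finset.mem_univ a₀, by rwa [hva]⟩))
        have h2 := Subalgebra.smul_mem _ h1
          ((Finset.univ.filter fun a => (v (Sum.inl a)).isLeft).card : ℂ)⁻¹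
        rwa [smul_smul, inv_mul_cancel₀ hne, one_smul] at h2
      · intro a ha
        congr 1
        refine fuse_eq_of_glue_eq fun i => ?_
        by_cases hi : i = j
        · subst hi
          rw [Equiv.Perm.mul_apply, Equiv.swap_apply_right]
          obtain ⟨b, hb⟩ := Sum.isLeft_iff.1 (Finset.mem_filter.1 ha).2
          obtain ⟨c, hc⟩ := Sum.isLeft_iff.1 hj
          rw [hb, hc]
          rfl
        · rw [hvai a i hi]
    · refine ih _ (hright _ ?_ (hvai a))
      rw [Equiv.Perm.mul_apply, Equiv.swap_apply_right]
      simpa using (Finset.mem_filter.1 ha).2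

theorem phi_surjective (hk : 0 < k) : Function.Surjective (phi k n hk) := by
  intro x
  refine induction (fun x => x ∈ (phi k n hk).range) x (zero_mem _)
    (fun x y hx hy => add_mem hx hy) fun c w => ?_
  exact Subalgebra.smul_mem _ (ofDiagram_fuse_mem_range hk _ w rfl) c

end FusedAlg
end

/-! ### Signed permutations and their normal forms -/

namespace SignedPerm

variable {n : ℕ}

theorem apply_not (w : SignedPerm n) (i : Fin n) (b : Bool) :
    w.1 (i, !b) = ((w.1 (i, b)).1, !(w.1 (i, b)).2) := w.2 i b

theorem apply_fst (w : SignedPerm n) (i : Fin n) (b : Bool) :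
    (w.1 (i, b)).1 = (w.1 (i, false)).1 := by
  cases b
  · rfl
  · exact (congrArg Prod.fst (apply_not w i false) :)

theorem apply_snd (w : SignedPerm n) (i : Fin n) (b : Bool) :
    (w.1 (i, b)).2 = xor b (w.1 (i, false)).2 := by
  cases b
  · simp
  · simpa using congrArg Prod.snd (apply_not w i false)

theorem inv_apply_self (w : SignedPerm n) (x : Fin n × Bool) : (w⁻¹).1 (w.1 x) = x :=
  w.1.symm_apply_apply x

theorem apply_inv_self (w : SignedPerm n) (x : Fin n × Bool) : w.1 ((w⁻¹).1 x) = x :=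
  w.1.apply_symm_apply x

theorem mul_apply (v w : SignedPerm n) (x : Fin n × Bool) : (v * w).1 x = v.1 (w.1 x) := rfl

/-- The permutation obtained by forgetting the bars. -/
def abs : SignedPerm n →* Equiv.Perm (Fin n) where
  toFun w :=
    { toFun := fun i => (w.1 (i, false)).1
      invFun := fun i => ((w⁻¹).1 (i, false)).1
      left_inv := fun i => by
        change ((w⁻¹).1 ((w.1 (i, false)).1, false)).1 = i
        rw [← apply_fst _ _ (w.1 (i, false)).2, Prod.mk.eta, inv_apply_self]
      right_inv := fun i => by
        change (w.1 (((w⁻¹).1 (i, false)).1, false)).1 = i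
        rw [← apply_fst _ _ ((w⁻¹).1 (i, false)).2, Prod.mk.eta, apply_inv_self] }
  map_one' := rfl
  map_mul' v w := by
    ext i
    change ((v.1 (w.1 (i, false))).1 : ℕ) = (v.1 ((w.1 (i, false)).1, false)).1
    rw [← apply_fst v _ (w.1 (i, false)).2]

theorem abs_apply (w : SignedPerm n) (i : Fin n) : abs w i = (w.1 (i, false)).1 := rfl

/-- The set of barred values. -/
def bars (w : SignedPerm n) : Finset (Fin n) :=
  Finset.univ.filter fun v => ((w⁻¹).1 (v, false)).2 = true

theorem mem_bars {w : SignedPerm n} {v : Fin n} : v ∈ bars w ↔ ((w⁻¹).1 (v, false)).2 = true := by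
  simp [bars]

theorem abs_mem_bars {w : SignedPerm n} {i : Fin n} :
    abs w i ∈ bars w ↔ (w.1 (i, false)).2 = true := by
  have h := inv_apply_self w (i, false)
  have h2 := congrArg Prod.snd h
  rw [← Prod.mk.eta (p := w.1 (i, false)), apply_snd] at h2
  rw [mem_bars, abs_apply]
  cases hb : (w.1 (i, false)).2 <;> simp [hb] at h2 ⊢ <;> exact h2

theorem tau_zero_apply {j : Fin n} (hj : (j : ℕ) = 0) (x : Fin n × Bool) :
    (tau n j).1 x = Equiv.swap (j, false) (j, true) x := by
  rw [tau, dif_pos hj]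

theorem tau_succ_apply {j : Fin n} (hj : (j : ℕ) ≠ 0) (x : Fin n × Bool) :
    (tau n j).1 x = (adjSwap n (j - 1) x.1, x.2) := by
  rw [tau, dif_neg hj, adjSwap_of_lt (by omega)]
  have : (⟨j - 1 + 1, by omega⟩ : Fin n) = j := Fin.ext (by simp only; omega)
  rw [this]
  rfl

theorem tau_inv (j : Fin n) : (tau n j)⁻¹ = tau n j := by
  rw [inv_eq_iff_mul_eq_one]
  refine Subtype.ext (Equiv.ext fun x => ?_)
  change (tau n j).1 ((tau n j).1 x) = x
  by_cases hj : (j : ℕ) = 0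
  · rw [tau_zero_apply hj, tau_zero_apply hj, Equiv.swap_apply_self]
  · rw [tau_succ_apply hj, tau_succ_apply hj, ← Equiv.Perm.mul_apply,
      (isCoxeterFamily_adjSwap n).sq _ (by omega)]
    rfl

theorem abs_tau_zero {j : Fin n} (hj : (j : ℕ) = 0) : abs (tau n j) = 1 := by
  refine Equiv.ext fun i => ?_
  rw [abs_apply, tau_zero_apply hj, Equiv.swap_apply_def]
  split_ifs with h1 h2
  · exact (congrArg Prod.fst h1).symm
  · exact (congrArg Prod.fst h2).symm
  · rfl

theorem abs_tau_succ {j : Fin n} (hj : (j : ℕ) ≠ 0) : abs (tau n j) = adjSwap n (j - 1) :=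
  Equiv.ext fun i => by rw [abs_apply, tau_succ_apply hj]

theorem bars_one : bars (1 : SignedPerm n) = ∅ := by
  ext v
  simp [mem_bars]

theorem bars_tau_succ_mul {j : Fin n} (hj : (j : ℕ) ≠ 0) (w : SignedPerm n) :
    bars (tau n j * w) = (bars w).map (adjSwap n (j - 1)).toEmbedding := by
  ext v
  rw [mem_bars, mul_inv_rev, tau_inv, mul_apply, tau_succ_apply hj, Finset.mem_map_equiv, mem_bars]
  have : (adjSwap n (j - 1)).symm = adjSwap n (j - 1) := by
    rw [adjSwap_of_lt (by omega)]
    exact Equiv.symm_swap _ _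
  rw [this]

theorem mem_bars_tau_zero_mul {j : Fin n} (hj : (j : ℕ) = 0) (w : SignedPerm n) (v : Fin n) :
    v ∈ bars (tau n j * w) ↔ if v = j then v ∉ bars w else v ∈ bars w := by
  rw [mem_bars, mem_bars, mul_inv_rev, tau_inv, mul_apply, tau_zero_apply hj]
  split_ifs with h
  · subst h
    rw [Equiv.swap_apply_left]
    have := apply_snd (w⁻¹) v true
    rw [this]
    simp
  · rw [Equiv.swap_apply_of_ne_of_ne] <;> simp [h]

/-- The number of occurrences of `τ_0` in a word. -/
def zeros (l : List (Fin n)) : ℕ := l.countP fun j : Fin n => decide ((j : ℕ) = 0)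

theorem zeros_append (l l' : List (Fin n)) : zeros (l ++ l') = zeros l + zeros l' :=
  List.countP_append

theorem zeros_cons_of_eq {j : Fin n} (hj : (j : ℕ) = 0) (l : List (Fin n)) :
    zeros (j :: l) = zeros l + 1 := List.countP_cons_of_pos (by simpa using hj)

theorem zeros_cons_of_ne {j : Fin n} (hj : (j : ℕ) ≠ 0) (l : List (Fin n)) :
    zeros (j :: l) = zeros l := List.countP_cons_of_neg (by simpa using hj)

theorem bars_tau_zero_mul_of_notMem {j : Fin n} (hj : (j : ℕ) = 0) {w : SignedPerm n}
    (h : j ∉ bars w) : bars (tau n j * w) = insert j (bars w) := by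
  ext v
  rw [mem_bars_tau_zero_mul hj, Finset.mem_insert]
  split_ifs with hv
  · subst hv; simpa using h
  · simp [hv]

theorem bars_tau_zero_mul_of_mem {j : Fin n} (hj : (j : ℕ) = 0) {w : SignedPerm n}
    (h : j ∈ bars w) : bars (tau n j * w) = (bars w).erase j := by
  ext v
  rw [mem_bars_tau_zero_mul hj, Finset.mem_erase]
  split_ifs with hv
  · subst hv; simpa using h
  · simp [hv]

/-- Only `τ_0` changes the number of bars, and by at most one each time. -/
theorem card_bars_le_zeros (l : List (Fin n)) :
    (bars (l.map (tau n)).prod).card ≤ zeros l := by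
  induction l with
  | nil => simp [bars_one]
  | cons j l ih =>
    rw [List.map_cons, List.prod_cons]
    by_cases hj : (j : ℕ) = 0
    · rw [zeros_cons_of_eq hj]
      by_cases h : j ∈ bars (l.map (tau n)).prod
      · rw [bars_tau_zero_mul_of_mem hj h]
        exact (Finset.card_le_card (Finset.erase_subset _ _)).trans (ih.trans (Nat.le_succ _))
      · rw [bars_tau_zero_mul_of_notMem hj h, Finset.card_insert_of_notMem h]
        exact Nat.succ_le_succ ih
    · rw [zeros_cons_of_ne hj, bars_tau_succ_mul hj,
        Finset.card_map]
      exact ih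

theorem getElem?_fullWord {j : Fin n} {l : ℕ} (hl : l ≤ 2 * j) :
    (fullWord j)[l]? = some ⟨if l ≤ j then j - l else l - j, by split_ifs <;> omega⟩ := by
  rw [fullWord]
  split_ifs with h
  · rw [List.getElem?_append_left (by simpa using Nat.lt_succ_of_le h), List.getElem?_ofFn,
      dif_pos (by omega)]
  · rw [List.getElem?_append_right (by simp; omega), List.getElem?_ofFn, List.length_ofFn,
      dif_pos (by omega)]
    simp only [Option.some.injEq, Fin.mk.injEq]
    omega

theorem take_fullWord_succ {j : Fin n} {l : ℕ} (hl : l ≤ 2 * j) :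
    (fullWord j).take (l + 1) = (fullWord j).take l
      ++ [⟨if l ≤ j then j - l else l - j, by split_ifs <;> omega⟩] := by
  rw [List.take_add_one, getElem?_fullWord hl]
  rfl

/-- The position sent to `j` by the prefix of length `l` of the word of index `j`. -/
def insertPos (j : Fin n) (l : ℕ) (hl : l ≤ 2 * j + 1) : Fin n × Bool :=
  (⟨if l ≤ j then j - l else l - j - 1, by split_ifs <;> omega⟩, decide (¬ l ≤ j))

/-- As the prefix grows, the position sent to `j` descends from `j` to the first position, gets its
bar when `τ_0` is read, and climbs back barred. No other position ever carries a bar, so a bar is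
created exactly when `τ_0` occurs. -/
theorem prefix_spec (j : Fin n) (l : ℕ) (hl : l ≤ 2 * j + 1) :
    let u := (((fullWord j).take l).map (tau n)).prod
    u.1 (insertPos j l hl) = (j, false) ∧ (∀ q ≠ (insertPos j l hl).1, ∀ b, (u.1 (q, b)).2 = b) ∧
    (∀ q, j < q → ∀ b, u.1 (q, b) = (q, b)) ∧
    zeros ((fullWord j).take l) = if l ≤ j then 0 else 1 := by
  induction l with
  | zero => exact ⟨rfl, fun _ _ _ => rfl, fun _ _ _ => rfl, by simp [zeros]⟩
  | succ l ih =>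
    obtain ⟨h1, h2, h3, h4⟩ := ih (by omega)
    intro u
    let i : Fin n := ⟨if l ≤ j then j - l else l - j, by split_ifs <;> omega⟩
    have hi : (i : ℕ) = if l ≤ j then j - l else l - j := rfl
    have hij : i ≤ j := by rw [Fin.le_def, hi]; split_ifs <;> omega
    have hu : ∀ x, u.1 x = (((fullWord j).take l).map (tau n)).prod.1 ((tau n i).1 x) := by
      intro x
      simp only [u]
      rw [take_fullWord_succ (by omega), List.map_append, List.prod_append, List.map_cons,
        List.map_nil, List.prod_cons, List.prod_nil, mul_one]
      rfl
    have hz : zeros ((fullWord j).take (l + 1))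
        = (if l ≤ j then 0 else 1) + if (i : ℕ) = 0 then 1 else 0 := by
      rw [take_fullWord_succ (by omega), zeros_append, h4, zeros, List.countP_singleton]
      simp only [decide_eq_true_eq]
      rfl
    by_cases h0 : (i : ℕ) = 0
    · have hl' : l = j := by split_ifs at hi <;> omega
      have ha : insertPos j l (by omega) = (i, false) := by
        simp only [insertPos, hl', le_refl, not_true, decide_false, if_true]
        exact Prod.ext (Fin.ext (by simp [h0])) rfl
      have hb : insertPos j (l + 1) hl = (i, true) := by
        simp only [insertPos, hl']
        exact Prod.ext (Fin.ext (by simp [h0])) (by simp)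
      rw [ha] at h1 h2
      rw [hb]
      refine ⟨?_, fun q hq b => ?_, fun q hq b => ?_, ?_⟩
      · rw [hu, tau_zero_apply h0, Equiv.swap_apply_right, h1]
      · rw [hu, tau_zero_apply h0, Equiv.swap_apply_of_ne_of_ne, h2 q hq] <;>
          simp only [ne_eq, Prod.mk.injEq, not_and] <;> exact fun e => absurd e hq
      · have : q ≠ i := (hij.trans_lt hq).ne'
        rw [hu, tau_zero_apply h0, Equiv.swap_apply_of_ne_of_ne, h3 q hq] <;> simp [this]
      · rw [hz, if_pos h0, hl']; simp
    · have ha : adjSwap n (i - 1) (insertPos j (l + 1) hl).1 = (insertPos j l (by omega)).1 := by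
        rw [adjSwap_of_lt (by omega)]
        by_cases hlj : l ≤ j
        · rw [if_pos hlj] at hi
          rw [show (insertPos j (l + 1) hl).1 = ⟨i - 1, by omega⟩ from Fin.ext (by
            simp only [insertPos]; split_ifs <;> omega), Equiv.swap_apply_left]
          refine Fin.ext ?_
          simp only [insertPos, if_pos hlj]
          omega
        · rw [if_neg hlj] at hi
          rw [show (insertPos j (l + 1) hl).1 = ⟨i - 1 + 1, by omega⟩ from Fin.ext (by
            simp only [insertPos]; split_ifs <;> omega), Equiv.swap_apply_right]
          refine Fin.ext ?_
          simp only [insertPos, if_neg hlj]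
          omega
      have hiff : l ≤ j ↔ l + 1 ≤ j := by split_ifs at hi <;> omega
      have hb : (insertPos j (l + 1) hl).2 = (insertPos j l (by omega)).2 := by
        simp only [insertPos, ← hiff]
      refine ⟨?_, fun q hq b => ?_, fun q hq b => ?_, ?_⟩
      · rw [hu, tau_succ_apply h0, ha, hb, h1]
      · rw [hu, tau_succ_apply h0, h2]
        rw [← ha]
        exact fun e => hq ((adjSwap n (i - 1)).injective e)
      · rw [hu, tau_succ_apply h0, adjSwap_of_lt (by omega), Equiv.swap_apply_of_ne_of_ne, h3 q hq]
        · intro e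
          have := congrArg Fin.val e
          simp only at this
          have := Fin.lt_def.1 hq
          have := Fin.le_def.1 hij
          omega
        · intro e
          have := congrArg Fin.val e
          simp only at this
          have := Fin.lt_def.1 hq
          have := Fin.le_def.1 hij
          omega
      · rw [hz, if_neg h0, add_zero]
        simp only [hiff]

/-- The word of the first `m` parts of a normal form. -/
def NormalForm.wordUpTo (c : NormalForm n) : ℕ → List (Fin n)
  | 0 => []
  | m + 1 => c.wordUpTo m ++ if h : m < n then (fullWord ⟨m, h⟩).take (c ⟨m, h⟩) else []

theorem NormalForm.word_eq_wordUpTo (c : NormalForm n) : c.word = c.wordUpTo n := by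
  have h : ∀ m ≤ n, ((List.ofFn fun j : Fin n => (fullWord j).take (c j)).take m).flatten
      = c.wordUpTo m := by
    intro m hm
    induction m with
    | zero => rfl
    | succ m ih =>
      rw [List.take_add_one, List.flatten_append, ih (by omega), wordUpTo, List.getElem?_ofFn]
      simp only [dif_pos (show m < n from hm)]
      simp
  rw [← h n le_rfl, List.take_of_length_le (by simp)]
  rfl

theorem NormalForm.wordUpTo_congr {c c' : NormalForm n} {m : ℕ}
    (h : ∀ j : Fin n, (j : ℕ) < m → c j = c' j) : c.wordUpTo m = c'.wordUpTo m := by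
  induction m with
  | zero => rfl
  | succ m ih =>
    rw [wordUpTo, wordUpTo, ih fun j hj => h j (by omega)]
    split_ifs with hm
    · rw [h ⟨m, hm⟩ (Nat.lt_succ_self m)]
    · rfl

/-- The blocks before index `j` fix `j`, so the new block decides whether the value `j` is barred
and leaves the other bars alone. Thus no `τ_0` of a normal form is wasted, which is what its leading
term requires. -/
theorem NormalForm.card_bars_wordUpTo (c : NormalForm n) (m : ℕ) (hm : m ≤ n) :
    (∀ i : Fin n, m ≤ i → ∀ b, ((c.wordUpTo m).map (tau n)).prod.1 (i, b) = (i, b)) ∧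
    (bars ((c.wordUpTo m).map (tau n)).prod).card = zeros (c.wordUpTo m) := by
  induction m with
  | zero => exact ⟨fun _ _ _ => rfl, by simp [wordUpTo, zeros, bars_one]⟩
  | succ m ih =>
    obtain ⟨ih1, ih2⟩ := ih (by omega)
    have hm' : m < n := hm
    let j : Fin n := ⟨m, hm'⟩
    have hcj : (c j : ℕ) ≤ 2 * j + 1 := by have := (c j).2; omega
    obtain ⟨h1, h2, h3, h4⟩ := prefix_spec j (c j) hcj
    rw [wordUpTo, dif_pos hm', zeros_append, List.map_append, List.prod_append]
    change (∀ i : Fin n, m + 1 ≤ i → ∀ b, (_ * (((fullWord j).take (c j)).map (tau n)).prod).1 _ = _)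
      ∧ (bars (_ * (((fullWord j).take (c j)).map (tau n)).prod)).card
        = _ + zeros ((fullWord j).take (c j))
    rw [h4, ← ih2]
    generalize (((fullWord j).take (c j)).map (tau n)).prod = u at h1 h2 h3
    generalize ((c.wordUpTo m).map (tau n)).prod = w at ih1
    refine ⟨fun i hi b => ?_, ?_⟩
    · rw [mul_apply, h3 i (Fin.lt_def.2 hi), ih1 i (by omega)]
    have hwj : (w⁻¹).1 (j, false) = (j, false) := by
      conv_lhs => rw [← ih1 j le_rfl false, inv_apply_self]
    have huj : (u⁻¹).1 (j, false) = insertPos j (c j) hcj := by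
      rw [← h1, inv_apply_self]
    have hj : j ∉ bars w := by rw [mem_bars, hwj]; simp
    have hmem : ∀ v, v ∈ bars (w * u) ↔ if v = j then ¬ ((c j : ℕ) ≤ j) else v ∈ bars w := by
      intro v
      rw [mem_bars, mul_inv_rev, mul_apply]
      split_ifs with hv
      · subst hv
        rw [hwj, huj]
        simp [insertPos]
      · rw [mem_bars]
        have hx : ((w⁻¹).1 (v, false)).1 ≠ j := by
          intro e
          have e2 := apply_inv_self w (v, false)
          rw [← Prod.mk.eta (p := (w⁻¹).1 (v, false)), e, ih1 j le_rfl] at e2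
          exact hv (congrArg Prod.fst e2).symm
        generalize (w⁻¹).1 (v, false) = x at hx
        have hy := apply_inv_self u x
        generalize (u⁻¹).1 x = y at hy
        have hy1 : y.1 ≠ (insertPos j (c j) hcj).1 := by
          intro e
          have h5 := congrArg Prod.fst h1
          rw [← Prod.mk.eta (p := insertPos j (c j) hcj), apply_fst, ← e, ← apply_fst u y.1 y.2,
            Prod.mk.eta, hy] at h5
          exact hx h5
        have := h2 y.1 hy1 y.2
        rw [Prod.mk.eta, hy] at this
        rw [this]
    split_ifs with hc
    · rw [add_zero]
      congr 1
      ext v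
      rw [hmem]
      split_ifs with hv
      · subst hv
        exact ⟨fun h => absurd hc h, fun h => absurd h hj⟩
      · rfl
    · rw [← Finset.card_insert_of_notMem hj]
      congr 1
      ext v
      rw [hmem, Finset.mem_insert]
      split_ifs with hv
      · exact ⟨fun _ => Or.inl hv, fun _ => hc⟩
      · simp [hv]

theorem NormalForm.card_bars (c : NormalForm n) : (bars c.toSignedPerm).card = zeros c.word := by
  rw [toSignedPerm, word_eq_wordUpTo]
  exact (c.card_bars_wordUpTo n le_rfl).2

/-- Peel off the largest moved index `j`: the prefix that sends `w⁻¹ j` to `j` can be divided out on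
the right, and the quotient fixes `j`. -/
theorem NormalForm.exists_wordUpTo (m : ℕ) (hm : m ≤ n) : ∀ w : SignedPerm n,
    (∀ i : Fin n, m ≤ i → ∀ b, w.1 (i, b) = (i, b)) →
    ∃ c : NormalForm n, ((c.wordUpTo m).map (tau n)).prod = w := by
  induction m with
  | zero =>
    intro w hw
    exact ⟨Classical.arbitrary _, Subtype.ext (Equiv.ext fun x => (hw x.1 (Nat.zero_le _) x.2).symm)⟩
  | succ m ih =>
    intro w hw
    let j : Fin n := ⟨m, hm⟩
    obtain ⟨l, hl, hpos⟩ : ∃ (l : ℕ) (hl : l ≤ 2 * j + 1),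
        insertPos j l hl = (w⁻¹).1 (j, false) := by
      have hp : ((w⁻¹).1 (j, false)).1 ≤ j := by
        by_contra! h
        have e := apply_inv_self w (j, false)
        rw [← Prod.mk.eta (p := (w⁻¹).1 (j, false)), hw _ h] at e
        exact h.ne' (congrArg Prod.fst e)
      generalize (w⁻¹).1 (j, false) = x at hp
      obtain ⟨p, b⟩ := x
      have hp' : (p : ℕ) ≤ j := hp
      -- An unbarred position `p` is reached on the way down, after `j - p` letters; a barred one on
      -- the way up, after `j + 1 + p` letters.
      cases b
      · refine ⟨j - p, by omega, Prod.ext (Fin.ext ?_) ?_⟩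
        · simp only [insertPos, Nat.sub_le, if_true]; omega
        · simp [insertPos]
      · refine ⟨j + 1 + p, by omega, Prod.ext (Fin.ext ?_) ?_⟩
        · simp only [insertPos]; rw [if_neg (by omega)]; omega
        · simp only [insertPos, decide_eq_true_eq]; omega
    obtain ⟨h1, -, h3, -⟩ := prefix_spec j l hl
    obtain ⟨c, hc⟩ := ih (by omega) (w * ((((fullWord j).take l).map (tau n)).prod)⁻¹) (by
      generalize (((fullWord j).take l).map (tau n)).prod = u at h1 h3
      intro i hi b
      rw [mul_apply]
      rcases Nat.lt_or_ge m i with h | h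
      · have : (u⁻¹).1 (i, b) = (i, b) := by
          conv_lhs => rw [← h3 i h b, inv_apply_self]
        rw [this, hw i h]
      · obtain rfl : i = j := Fin.ext (le_antisymm h hi)
        have hf : (w * u⁻¹).1 (j, false) = (j, false) := by
          rw [mul_apply, show (u⁻¹).1 (j, false) = insertPos j l hl by rw [← h1, inv_apply_self],
            hpos, apply_inv_self]
        rw [← mul_apply]
        cases b
        · exact hf
        · have := apply_not (w * u⁻¹) j false
          rw [hf] at this
          exact this)
    refine ⟨Function.update c j ⟨l, by omega⟩, ?_⟩
    rw [wordUpTo, dif_pos (show m < n from hm), List.map_append, List.prod_append,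
      wordUpTo_congr (c' := c), hc]
    · change _ * (((fullWord j).take (Function.update c j _ j)).map (tau n)).prod = w
      rw [Function.update_self, inv_mul_cancel_right]
    · intro i hi
      rw [Function.update_of_ne]
      rintro rfl
      exact lt_irrefl _ hi

theorem NormalForm.toSignedPerm_surjective :
    Function.Surjective (NormalForm.toSignedPerm (n := n)) := by
  intro w
  obtain ⟨c, hc⟩ := NormalForm.exists_wordUpTo n le_rfl w fun i hi => absurd i.2 (by omega)
  exact ⟨c, by rw [toSignedPerm, word_eq_wordUpTo, hc]⟩

/-- Existence of normal forms is enough here: the spanning argument uses only that the word has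
product `w` and that its number of `τ_0` is the number of bars. -/
theorem prod_word_normalForm (w : SignedPerm n) :
    ((normalForm w).word.map (tau n)).prod = w :=
  Function.rightInverse_invFun NormalForm.toSignedPerm_surjective w

theorem zeros_word_normalForm (w : SignedPerm n) :
    zeros (normalForm w).word = (bars w).card := by
  rw [← NormalForm.card_bars, NormalForm.toSignedPerm, prod_word_normalForm]

end SignedPerm

/-! ### Signed permutations with decreasing bars and their diagrams -/

namespace SignedPerm

variable {n : ℕ}

theorem apply_eq (w : SignedPerm n) (i : Fin n) (b : Bool) :
    w.1 (i, b) = (abs w i, xor b (decide (abs w i ∈ bars w))) := by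
  refine Prod.ext (apply_fst w i b) ?_
  rw [apply_snd]
  congr 1
  rw [Bool.eq_iff_iff, decide_eq_true_eq]
  exact abs_mem_bars.symm

theorem ext_abs_bars {w w' : SignedPerm n} (h : abs w = abs w') (h' : bars w = bars w') :
    w = w' := by
  refine Subtype.ext (Equiv.ext fun x => ?_)
  rw [← Prod.mk.eta (p := x), apply_eq, apply_eq, h, h']

theorem avoids_iff {w : SignedPerm n} : Avoids w ↔
    ∀ i j : Fin n, i < j → abs w i ∈ bars w → abs w j ∈ bars w → abs w j < abs w i := by
  simp only [Avoids, abs_mem_bars]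
  rfl

/-- A signed permutation may have any underlying permutation and any set of barred values. -/
theorem exists_abs_bars (a : Equiv.Perm (Fin n)) (I : Finset (Fin n)) :
    ∃ w : SignedPerm n, abs w = a ∧ bars w = I := by
  let w : SignedPerm n :=
    ⟨{ toFun := fun x => (a x.1, xor x.2 (decide (a x.1 ∈ I)))
       invFun := fun x => (a.symm x.1, xor x.2 (decide (x.1 ∈ I)))
       left_inv := fun x => by simp
       right_inv := fun x => by simp }, fun i b => by simp⟩
  have ha : abs w = a := rfl
  refine ⟨w, ha, Finset.ext fun v => ?_⟩
  rw [← a.apply_symm_apply v, ← ha, abs_mem_bars, ha]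
  simp [w]

/-- Keep the positions of the values in `I` and rearrange these values in decreasing order; `u`
performs the rearrangement. -/
theorem exists_avoids (I : Finset (Fin n)) (w : Equiv.Perm (Fin n)) :
    ∃ v : SignedPerm n, Avoids v ∧ bars v = I ∧
      ∃ u : Equiv.Perm (Fin n), (∀ i ∉ I, u i = i) ∧ abs v = u * w := by
  let P := I.map w.symm.toEmbedding
  have hP : ∀ i, i ∈ P ↔ w i ∈ I := fun i => by simp [P, Finset.mem_map_equiv]
  let oP := P.orderIsoOfFin (k := I.card) (Finset.card_map _)
  let oI := I.orderIsoOfFin rfl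
  let e : {i // i ∈ I} ≃ {i // i ∈ P} := w.symm.subtypeEquiv fun i => by
    rw [hP, Equiv.apply_symm_apply]
  -- Go from a value to its position, take the rank of this position among those holding values of
  -- `I`, reverse it, and return the value of `I` with that rank.
  let u' : Equiv.Perm {i // i ∈ I} :=
    e.trans ((oP.symm.toEquiv.trans Fin.revPerm).trans oI.toEquiv)
  let u := Equiv.Perm.ofSubtype u'
  have hu : ∀ i ∉ I, u i = i := fun i hi => Equiv.Perm.ofSubtype_apply_of_not_mem u' hi
  have hu' : ∀ i (hi : w i ∈ I), u (w i) = oI (Fin.rev (oP.symm ⟨i, (hP i).2 hi⟩)) := by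
    intro i hi
    rw [Equiv.Perm.ofSubtype_apply_of_mem u' hi]
    simp [u', e]
  obtain ⟨v, hv, hvI⟩ := exists_abs_bars (u * w) I
  refine ⟨v, avoids_iff.2 fun i j hij hi hj => ?_, hvI, u, hu, hv⟩
  rw [hv, hvI, Equiv.Perm.mul_apply] at hi hj
  have hmem : ∀ x, u x ∈ I → x ∈ I := fun x hx => by
    by_contra h
    rw [hu x h] at hx
    exact h hx
  rw [hv, Equiv.Perm.mul_apply, Equiv.Perm.mul_apply, hu' i (hmem _ hi), hu' j (hmem _ hj)]
  have : oP.symm ⟨i, (hP i).2 (hmem _ hi)⟩ < oP.symm ⟨j, (hP j).2 (hmem _ hj)⟩ :=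
    oP.symm.strictMono hij
  exact oI.strictMono (Fin.rev_lt_rev.2 this)

/-- The fused permutation obtained by sending the barred positions and values to the thick point. -/
def toFusedPerm {k : ℕ} (hnk : n ≤ k) (w : SignedPerm n) : FusedPerm k n where
  S := Fin.cons (Multiset.replicate (k - (bars w).card) 0
      + ((bars w).map (abs w).symm.toEmbedding).val.map Fin.succ)
    fun v => {if v ∈ bars w then 0 else ((abs w).symm v).succ}
  card_zero := by
    -- With `n ≤ k`, this makes the truncated subtraction `k - (bars w).card` exact.
    have : (bars w).card ≤ n := by simpa using (bars w).card_le_univ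
    simp only [Fin.cons_zero, Multiset.card_add, Multiset.card_replicate, Multiset.card_map,
      Finset.card_val, Finset.card_map]
    omega
  card_succ i := by simp
  count_zero := by
    have : (bars w).card ≤ n := by simpa using (bars w).card_le_univ
    have h0 : ((((bars w).map (abs w).symm.toEmbedding).val.map Fin.succ).count 0) = 0 := by
      rw [Multiset.count_eq_zero, Multiset.mem_map]
      rintro ⟨x, -, hx⟩
      exact Fin.succ_ne_zero x hx
    have h1 : ∀ v : Fin n, Multiset.count (0 : Fin (n + 1))
        {if v ∈ bars w then 0 else ((abs w).symm v).succ} = if v ∈ bars w then 1 else 0 := by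
      intro v
      rw [Multiset.count_singleton]
      split_ifs with h2 h3 h3
      · rfl
      · exact absurd rfl h3
      · exact absurd h3.symm (Fin.succ_ne_zero _)
      · rfl
    simp only [Fin.sum_univ_succ, Fin.cons_zero, Fin.cons_succ, Multiset.count_add, h0, h1,
      Multiset.count_replicate_self, Finset.sum_boole, Finset.filter_mem_eq_inter,
      Finset.univ_inter, Nat.cast_id]
    omega
  count_succ j := by
    have h0 : ((((bars w).map (abs w).symm.toEmbedding).val.map Fin.succ).count j.succ)
        = if abs w j ∈ bars w then 1 else 0 := by
      rw [Multiset.count_map_eq_count' _ _ (Fin.succ_injective n),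
        Multiset.count_eq_of_nodup (Finset.nodup _)]
      simp only [Finset.mem_val, Finset.mem_map_equiv, Equiv.symm_symm]
    have h1 : ∀ v : Fin n, Multiset.count j.succ
        {if v ∈ bars w then 0 else ((abs w).symm v).succ}
        = if v = abs w j then (if abs w j ∈ bars w then 0 else 1) else 0 := by
      intro v
      rw [Multiset.count_singleton]
      by_cases hv : v = abs w j
      · subst hv
        by_cases hb : abs w j ∈ bars w <;> simp [hb]
      · have : (abs w).symm v ≠ j := fun e => hv (by rw [← e, Equiv.apply_symm_apply])
        by_cases hb : v ∈ bars w <;> simp [hb, hv, this.symm]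
    simp only [Fin.sum_univ_succ, Fin.cons_zero, Fin.cons_succ, Multiset.count_add, h0, h1,
      Finset.sum_ite_eq', Finset.mem_univ, if_true, Multiset.count_replicate,
      (Fin.succ_ne_zero j).symm, if_false, zero_add]
    split_ifs <;> rfl

/-- The thin top points joined to the thick one give the barred values, and the others give the
unbarred values with their positions. The remaining values fill the remaining positions in
decreasing order, which leaves no choice. -/
theorem toFusedPerm_injOn {k : ℕ} (hnk : n ≤ k) {w w' : SignedPerm n} (hw : Avoids w)
    (hw' : Avoids w') (h : toFusedPerm hnk w = toFusedPerm hnk w') : w = w' := by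
  have hS : ∀ v : Fin n, (if v ∈ bars w then (0 : Fin (n + 1)) else ((abs w).symm v).succ)
      = if v ∈ bars w' then 0 else ((abs w').symm v).succ := fun v =>
    Multiset.singleton_inj.1 (congrFun (congrArg FusedPerm.S h) v.succ)
  have hb : bars w = bars w' := by
    ext v
    have := hS v
    split_ifs at this with h1 h2 h2
    · simp [h1, h2]
    · exact absurd this.symm (Fin.succ_ne_zero _)
    · exact absurd this (Fin.succ_ne_zero _)
    · simp [h1, h2]
  have hs : ∀ v ∉ bars w, (abs w).symm v = (abs w').symm v := fun v hv => by
    have := hS v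
    rw [if_neg hv, if_neg (hb ▸ hv)] at this
    exact Fin.succ_injective _ this
  have hout : ∀ i, abs w i ∉ bars w → abs w' i = abs w i := fun i hi => by
    have := hs _ hi
    rw [Equiv.symm_apply_apply] at this
    rw [this, Equiv.apply_symm_apply, ← this]
  have hout' : ∀ i, abs w' i ∉ bars w → abs w' i = abs w i := fun i hi => by
    have := hs _ hi
    rw [Equiv.symm_apply_apply] at this
    rw [← this, Equiv.apply_symm_apply, this]
  have hmem : ∀ i, abs w i ∈ bars w ↔ abs w' i ∈ bars w := fun i => by
    by_cases h1 : abs w i ∈ bars w <;> by_cases h2 : abs w' i ∈ bars w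
    · simp [h1, h2]
    · exact absurd (hout' i h2 ▸ h1) h2
    · exact absurd (hout i h1 ▸ h2) h1
    · simp [h1, h2]
  refine ext_abs_bars (Equiv.ext fun i => ?_) hb
  by_cases hi : abs w i ∈ bars w
  · let f : {i // abs w i ∈ bars w} → (Fin n)ᵒᵈ := fun i => OrderDual.toDual (abs w i)
    let f' : {i // abs w i ∈ bars w} → (Fin n)ᵒᵈ := fun i => OrderDual.toDual (abs w' i)
    have hf : StrictMono f := fun i j hij => avoids_iff.1 hw i j hij i.2 j.2
    have hf' : StrictMono f' := fun i j hij =>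
      avoids_iff.1 hw' i j hij (hb ▸ (hmem i).1 i.2) (hb ▸ (hmem j).1 j.2)
    have hr : Set.range f = Set.range f' := by
      ext v
      constructor
      · rintro ⟨j, rfl⟩
        exact ⟨⟨(abs w').symm (abs w j), by rw [hmem, Equiv.apply_symm_apply]; exact j.2⟩,
          (abs w').apply_symm_apply _⟩
      · rintro ⟨j, rfl⟩
        exact ⟨⟨(abs w).symm (abs w' j), by rw [Equiv.apply_symm_apply]; exact (hmem j).1 j.2⟩,
          (abs w).apply_symm_apply _⟩
    exact congrFun ((StrictMono.range_inj hf hf').1 hr) ⟨i, hi⟩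
  · exact (hout i hi).symm

end SignedPerm

/-! ### Leading terms of words -/

namespace IsJucysMurphy

open SignedPerm

variable {A : Type*} [Ring A] [Algebra ℂ A] {n : ℕ} {X : Fin n → A}
  {T : Equiv.Perm (Fin n) →* A} {c : ℂ}

/-- Reading from the right, `x₁` inserts the first index in the leading product and a transposition
permutes its indices, just as `τ_0` and `τ_j` act on the barred values. The hypothesis `hl` ensures
that no `τ_0` removes a bar. -/
theorem prod_word_sub_mem_below (H : IsJucysMurphy X T c) {B : Fin n → A}
    (hB0 : ∀ j : Fin n, (j : ℕ) = 0 → B j = X j)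
    (hB : ∀ j : Fin n, (j : ℕ) ≠ 0 → B j = T (adjSwap n (j - 1))) (l : List (Fin n))
    (hl : (bars (l.map (tau n)).prod).card = zeros l) :
    (l.map B).prod - H.prod (bars (l.map (tau n)).prod) * T (abs (l.map (tau n)).prod)
      ∈ H.below (zeros l) := by
  induction l with
  | nil => simp [bars_one, H.prod_empty]
  | cons j l ih =>
    have hle := card_bars_le_zeros l
    simp only [List.map_cons, List.prod_cons] at hl ⊢
    by_cases hj : (j : ℕ) = 0
    · rw [zeros_cons_of_eq hj] at hl ⊢
      -- Removing a bar would leave fewer bars than letters `τ_0`, against `hl`.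
      by_cases h : j ∈ bars (l.map (tau n)).prod
      · rw [bars_tau_zero_mul_of_mem hj h, Finset.card_erase_of_mem h] at hl
        omega
      · rw [bars_tau_zero_mul_of_notMem hj h, Finset.card_insert_of_notMem h] at hl
        have h1 := ih (Nat.succ_injective hl)
        have hj' : j = ⟨0, by omega⟩ := Fin.ext hj
        rw [bars_tau_zero_mul_of_notMem hj h, H.prod_insert h, map_mul, abs_tau_zero hj, one_mul,
          hB0 j hj, mul_assoc, ← mul_sub, hj']
        exact H.first_mul_mem_below _ h1
    · rw [zeros_cons_of_ne hj] at hl ⊢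
      rw [bars_tau_succ_mul hj, Finset.card_map] at hl
      have h1 := H.perm_mul_mem_below (ih hl) (adjSwap n (j - 1))
      have h2 := H.mul_perm_mem_below
        (H.perm_mul_prod (adjSwap n (j - 1)) (bars (l.map (tau n)).prod))
        (abs (l.map (tau n)).prod)
      rw [hl] at h2
      rw [bars_tau_succ_mul hj, map_mul, abs_tau_succ hj, hB j hj, map_mul]
      convert add_mem h1 h2 using 1
      rw [mul_sub, sub_mul]
      simp only [mul_assoc]
      abel

/-- Modulo lower terms `X_I T_w` equals `X_I T_u T_w` for `u` supported on `I`; for the right `u`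
this is the leading term of a signed permutation with decreasing bars. Induction on the filtration
concludes. -/
theorem span_avoids_eq_top (H : IsJucysMurphy X T c) {B : Fin n → A}
    (hB0 : ∀ j : Fin n, (j : ℕ) = 0 → B j = X j)
    (hB : ∀ j : Fin n, (j : ℕ) ≠ 0 → B j = T (adjSwap n (j - 1)))
    (hc : ∀ h : 1 < n, X ⟨0, by omega⟩ * X ⟨1, h⟩ * T (adjSwap n 0)
      = X ⟨0, by omega⟩ * X ⟨1, h⟩) (r : ℕ) :
    H.below r ≤ Submodule.span ℂ (Set.range fun w : {w : SignedPerm n // Avoids w} =>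
      ((normalForm w.1).word.map B).prod) := by
  induction r with
  | zero =>
    refine Submodule.span_le.2 ?_
    rintro _ ⟨I, w, hI, rfl⟩
    exact absurd hI (Nat.not_lt_zero _)
  | succ r ih =>
    refine Submodule.span_le.2 ?_
    rintro _ ⟨I, w, hI, rfl⟩
    rcases Nat.lt_succ_iff_lt_or_eq.1 hI with hI | rfl
    · exact ih (H.prod_mul_mem_below hI w)
    obtain ⟨v, hv, rfl, u, hu, huv⟩ := exists_avoids I w
    have h1 := H.prod_word_sub_mem_below hB0 hB (normalForm v).word
      (by rw [prod_word_normalForm, zeros_word_normalForm])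
    rw [prod_word_normalForm, zeros_word_normalForm, huv, map_mul] at h1
    have h2 := H.mul_perm_mem_below (H.prod_mul_perm hc (bars v) u hu) w
    have h3 := ih (add_mem h1 h2)
    have h4 : ((normalForm v).word.map B).prod ∈ Submodule.span ℂ (Set.range fun
        w : {w : SignedPerm n // Avoids w} => ((normalForm w.1).word.map B).prod) :=
      Submodule.subset_span ⟨⟨v, hv⟩, rfl⟩
    have h5 := sub_mem h4 h3
    change _ ∈ Submodule.span ℂ _
    convert h5 using 1
    rw [sub_mul, mul_assoc]
    abel

end IsJucysMurphy

/-! ### Relations in the Hecke algebra -/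

noncomputable section

namespace Hecke

variable {n : ℕ} {c : ℂ}

section Relations

variable {κ : Fin 2 → ℂ}

theorem s_mul_s (i : Fin (n - 1)) : s (κ := κ) i * s i = 1 := by
  simpa only [x, s, map_mul, map_one] using mk_rel (HeckeRel.s_sq (κ := κ) (n := n) i)

theorem x_comm (r u : Fin n) : x (κ := κ) r * x u = x u * x r := by
  simpa only [x, s, map_mul] using mk_rel (HeckeRel.x_x (κ := κ) (n := n) r u)

theorem x_mul_s (r : Fin n) (l : Fin (n - 1)) (h₁ : (r : ℕ) ≠ l) (h₂ : (r : ℕ) ≠ l + 1) :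
    x (κ := κ) r * s l = s l * x r := by
  simpa only [x, s, map_mul] using mk_rel (HeckeRel.x_s (κ := κ) (n := n) r l h₁ h₂)

theorem x_succ_eq (r : ℕ) (h : r < n - 1) : x (κ := κ) (⟨r + 1, by omega⟩ : Fin n)
    = s ⟨r, h⟩ * x ⟨r, by omega⟩ * s ⟨r, h⟩ + s ⟨r, h⟩ := by
  simpa only [x, s, map_mul, map_add] using mk_rel (HeckeRel.x_succ (κ := κ) (n := n) r h)

theorem s_mul_x (r : ℕ) (h : r < n - 1) : s (κ := κ) ⟨r, h⟩ * x (⟨r, by omega⟩ : Fin n)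
    = x ⟨r + 1, by omega⟩ * s ⟨r, h⟩ - 1 := by
  rw [x_succ_eq r h, add_mul, mul_assoc _ (s _) (s _), s_mul_s, mul_one, add_sub_cancel_right]

theorem s_mul_x_succ (r : ℕ) (h : r < n - 1) : s (κ := κ) ⟨r, h⟩ * x (⟨r + 1, by omega⟩ : Fin n)
    = x ⟨r, by omega⟩ * s ⟨r, h⟩ + 1 := by
  rw [x_succ_eq r h, mul_add, mul_assoc, ← mul_assoc (s _) (s _), s_mul_s, one_mul]

theorem mk_surjective (κ : Fin 2 → ℂ) (n : ℕ) : Function.Surjective (mk κ n) :=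
  RingQuot.mkAlgHom_surjective ℂ _

end Relations

theorem x_zero_sq (h : 0 < n) : x (κ := ![0, c]) (⟨0, h⟩ : Fin n) * x ⟨0, h⟩ = c • x ⟨0, h⟩ := by
  have := mk_rel (HeckeRel.cyclotomic (κ := ![0, c]) (n := n) h)
  simp only [map_mul, map_sub, map_zero, AlgHom.commutes, Matrix.cons_val_zero,
    Matrix.cons_val_one] at this
  simp only [sub_zero, mul_sub, Algebra.algebraMap_eq_smul_one, mul_smul_comm, mul_one] at this
  exact sub_eq_zero.1 this

/-- The images of the `x_i` in a quotient of the Hecke algebra form a family of Jucys–Murphy type. -/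
theorem exists_isJucysMurphy {A : Type*} [Ring A] [Algebra ℂ A] (f : Hecke ![0, c] n →ₐ[ℂ] A) :
    ∃ T : Equiv.Perm (Fin n) →* A, IsJucysMurphy (fun i => f (x i)) T c ∧
      ∀ i : Fin (n - 1), T (adjSwap n i) = f (s i) := by
  let g : ℕ → A := fun i => if h : i < n - 1 then f (s ⟨i, h⟩) else 1
  have hg : ∀ i (h : i < n - 1), g i = f (s ⟨i, h⟩) := fun i h => dif_pos h
  have hcox : IsCoxeterFamily (n - 1) g :=
    { sq := fun i hi => by rw [hg i hi, ← map_mul, s_mul_s, map_one]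
      comm := fun i j hij hj => by
        rw [hg i (by omega), hg j hj, ← map_mul, ← map_mul]
        congr 1
        simpa only [x, s, map_mul] using mk_rel (HeckeRel.s_comm (κ := ![0, c]) (n := n)
          ⟨i, by omega⟩ ⟨j, hj⟩ (Or.inl hij))
      braid := fun i hi => by
        rw [hg i (by omega), hg (i + 1) hi]
        simp only [← map_mul]
        congr 1
        simpa only [x, s, map_mul] using mk_rel (HeckeRel.braid (κ := ![0, c]) (n := n) i hi) }
  obtain ⟨T, hT⟩ := hcox.exists_hom
  have hT' : ∀ i (h : i < n - 1), T (adjSwap n i) = f (s ⟨i, h⟩) := fun i h =>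
    (hT i h).trans (hg i h)
  refine ⟨T, ⟨fun i j => ?_, fun i h => ?_, fun i h j h1 h2 => ?_, fun h => ?_⟩,
    fun i => hT' i i.2⟩
  · rw [← map_mul, x_comm, map_mul]
  · rw [hT' i (by omega), ← map_mul, s_mul_x i (by omega), map_sub, map_mul, map_one]
  · rw [hT' i (by omega), ← map_mul, ← map_mul, x_mul_s j ⟨i, by omega⟩ h1 h2]
  · rw [← map_mul, x_zero_sq h, map_smul]

/-- The top stage contains `1` and is stable under left multiplication by the generators. -/
theorem below_eq_top {A : Type*} [Ring A] [Algebra ℂ A] {f : Hecke ![0, c] n →ₐ[ℂ] A}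
    (hf : Function.Surjective f) {T : Equiv.Perm (Fin n) →* A}
    (H : IsJucysMurphy (fun i => f (x i)) T c)
    (hT : ∀ i : Fin (n - 1), T (adjSwap n i) = f (s i)) : H.below (n + 1) = ⊤ := by
  have key : ∀ F : FreeAlgebra ℂ (HeckeGen n), ∀ v ∈ H.below (n + 1),
      f (mk _ n F) * v ∈ H.below (n + 1) := by
    intro F
    induction F using FreeAlgebra.induction with
    | grade0 r =>
      intro v hv
      rw [AlgHom.commutes, AlgHom.commutes, ← Algebra.smul_def]
      exact Submodule.smul_mem _ r hv
    | grade1 y =>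
      intro v hv
      rcases y with i | i
      · exact H.mul_mem_below_top i hv
      · change f (s i) * v ∈ _
        rw [← hT]
        exact H.perm_mul_mem_below hv _
    | mul a b ha hb =>
      intro v hv
      rw [map_mul, map_mul, mul_assoc]
      exact ha _ (hb v hv)
    | add a b ha hb =>
      intro v hv
      rw [map_add, map_add, add_mul]
      exact add_mem (ha v hv) (hb v hv)
  refine eq_top_iff.2 fun a _ => ?_
  obtain ⟨b, rfl⟩ := hf a
  obtain ⟨F, rfl⟩ := mk_surjective _ n b
  have := key F 1 (by
    rw [← H.prod_empty]
    exact H.prod_mem_below (by simp))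
  rwa [mul_one] at this

/-- In a quotient where `x₁ x₂ (1 - s₁) = 0`, the elements attached to the signed permutations with
decreasing barred numbers span. -/
theorem span_sOf_eq_top {A : Type*} [Ring A] [Algebra ℂ A] {f : Hecke ![0, c] n →ₐ[ℂ] A}
    (hf : Function.Surjective f)
    (hc : ∀ h : 1 < n, f (x ⟨0, by omega⟩ * x ⟨1, h⟩ * s ⟨0, by omega⟩)
      = f (x ⟨0, by omega⟩ * x ⟨1, h⟩)) :
    Submodule.span ℂ (Set.range fun w : {w : SignedPerm n // SignedPerm.Avoids w} =>
      f (sOf _ w.1)) = ⊤ := by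
  obtain ⟨T, H, hT⟩ := exists_isJucysMurphy f
  have h := H.span_avoids_eq_top (B := fun j => f (sB _ j))
    (fun j hj => by rw [sB, dif_pos hj])
    (fun j hj => by rw [sB, dif_neg hj, ← hT])
    (fun h => by
      have := hT ⟨0, by omega⟩
      simp only at this
      rw [this]
      simpa only [map_mul] using hc h) (n + 1)
  rw [below_eq_top hf H hT, top_le_iff] at h
  rw [← h]
  congr 2
  ext w
  rw [sOf, map_list_prod, List.map_map]
  rfl

/-! ### The idempotent and the quotient relation -/

/-- The element `x₁ x₂ (1 - s₁)`. -/
def gap (κ : Fin 2 → ℂ) (h : 2 ≤ n) : Hecke κ n :=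
  x ⟨0, by omega⟩ * x ⟨1, h⟩ - x ⟨0, by omega⟩ * x ⟨1, h⟩ * s ⟨0, by omega⟩

/-- Moving `s₁` past each of the two factors produces opposite corrections. -/
theorem s_mul_x_mul_x {κ : Fin 2 → ℂ} (h : 2 ≤ n) :
    s (κ := κ) (⟨0, by omega⟩ : Fin (n - 1)) * (x ⟨0, by omega⟩ * x ⟨1, h⟩)
      = x ⟨0, by omega⟩ * x ⟨1, h⟩ * s ⟨0, by omega⟩ := by
  have h1 := s_mul_x (κ := κ) (n := n) 0 (by omega)
  have h2 := s_mul_x_succ (κ := κ) (n := n) 0 (by omega)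
  simp only [zero_add] at h1 h2
  rw [← mul_assoc, h1, sub_mul, one_mul, mul_assoc, h2, mul_add, mul_one, add_sub_cancel_right,
    ← mul_assoc, x_comm]

theorem s_mul_gap {κ : Fin 2 → ℂ} (h : 2 ≤ n) :
    s (κ := κ) (⟨0, by omega⟩ : Fin (n - 1)) * gap κ h = - gap κ h := by
  rw [gap, mul_sub, ← mul_assoc _ (x _ * x _), s_mul_x_mul_x, mul_assoc _ (s _) (s _), s_mul_s,
    mul_one, neg_sub]

theorem x_zero_mul_gap (h : 2 ≤ n) :
    x (⟨0, by omega⟩ : Fin n) * gap ![0, c] h = c • gap ![0, c] h := by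
  rw [gap, mul_sub]
  simp only [← mul_assoc]
  rw [x_zero_sq, smul_mul_assoc, smul_mul_assoc, smul_sub]

/-- Together with `s_mul_gap` and `x_zero_mul_gap`, this shows that the gap spans a copy of the sign
character under left multiplication, or is zero; the eigenvalues `c` and `c - 1` are the contents of
the column in the second component. -/
theorem x_one_mul_gap (h : 2 ≤ n) :
    x (⟨1, h⟩ : Fin n) * gap ![0, c] h = (c - 1) • gap ![0, c] h := by
  have h1 := x_succ_eq (κ := ![0, c]) (n := n) 0 (by omega)
  simp only [zero_add] at h1
  rw [h1, add_mul, mul_assoc, s_mul_gap, mul_neg, mul_assoc, x_zero_mul_gap, mul_smul_comm,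
    s_mul_gap, smul_neg, neg_neg, sub_smul, one_smul, sub_eq_add_neg]

theorem aeval_mul_of_mul_eq_smul {A : Type*} [Ring A] [Algebra ℂ A] {y g : A} {a : ℂ}
    (h : y * g = a • g) (p : Polynomial ℂ) : Polynomial.aeval y p * g = p.eval a • g := by
  induction p using Polynomial.induction_on' with
  | add p q hp hq => rw [map_add, add_mul, hp, hq, Polynomial.eval_add, add_smul]
  | monomial m r =>
    rw [Polynomial.aeval_monomial, Polynomial.eval_monomial, mul_smul, mul_assoc,
      ← Algebra.smul_def]
    congr 1
    induction m with
    | zero => simp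
    | succ m ih => rw [pow_succ, mul_assoc, h, mul_smul_comm, ih, smul_smul, pow_succ']

/-- The interpolation polynomial of a finite set at one of its points. -/
def interp (S : Finset ℂ) (a : ℂ) : Polynomial ℂ :=
  ∏ b ∈ S.erase a, Polynomial.C (a - b)⁻¹ * (Polynomial.X - Polynomial.C b)

theorem eval_interp (S : Finset ℂ) (a : ℂ) : (interp S a).eval a = 1 := by
  rw [interp, Polynomial.eval_prod]
  refine Finset.prod_eq_one fun b hb => ?_
  have := sub_ne_zero.2 (Finset.ne_of_mem_erase hb).symm
  simp [inv_mul_cancel₀ this]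

theorem dvd_interp {S : Finset ℂ} {a b : ℂ} (hb : b ∈ S) (hab : b ≠ a) :
    Polynomial.X - Polynomial.C b ∣ interp S a :=
  (Dvd.intro_left _ rfl).trans (Finset.dvd_prod_of_mem _ (Finset.mem_erase.2 ⟨hab, hb⟩))

theorem incl_x {κ : Fin 2 → ℂ} {m : ℕ} (h : m ≤ n) (r : Fin m) :
    incl κ h (x r) = x (Fin.castLE h r) := by
  refine (RingQuot.liftAlgHom_mkAlgHom_apply ℂ _ _ _).trans ?_
  rw [lift_freeX]
  rfl

theorem incl_signIdempotent (k : ℕ) (h : 2 ≤ n) :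
    incl ![0, (k : ℂ) + 1] h (signIdempotent ![0, (k : ℂ) + 1] 2 1)
      = Polynomial.aeval (x (⟨0, by omega⟩ : Fin n))
          (interp (contentSet_finite ![0, (k : ℂ) + 1] 2).toFinset (k + 1))
        * Polynomial.aeval (x (⟨1, h⟩ : Fin n))
          (interp (contentSet_finite ![0, (k : ℂ) + 1] 2).toFinset k) := by
  have h0 : (columnTableau 2 1).content ![0, (k : ℂ) + 1] 0 = k + 1 := by
    change ((k : ℂ) + 1) + ((0 : ℕ) : ℂ) - ((0 : ℕ) : ℂ) = _
    simp
  have h1 : (columnTableau 2 1).content ![0, (k : ℂ) + 1] 1 = k := by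
    change ((k : ℂ) + 1) + ((0 : ℕ) : ℂ) - ((1 : ℕ) : ℂ) = _
    simp
  rw [signIdempotent, idempotentOf]
  simp only [List.ofFn_succ, List.ofFn_zero, List.prod_cons, List.prod_nil, mul_one, map_mul]
  rw [← Polynomial.aeval_algHom_apply, ← Polynomial.aeval_algHom_apply, incl_x, incl_x]
  change _ * Polynomial.aeval _ (∏ c ∈ (contentSet_finite ![0, (k : ℂ) + 1] 2).toFinset.erase
    ((columnTableau 2 1).content ![0, (k : ℂ) + 1] 1), Polynomial.C
      ((columnTableau 2 1).content ![0, (k : ℂ) + 1] 1 - c)⁻¹ * (Polynomial.X - Polynomial.C c)) = _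
  rw [h0, h1]
  rfl

/-- The standard tableau whose component `b` is a row of two boxes, the other one being empty. -/
def rowTableau (b : Fin 2) : StdBitableau 2 where
  shape l := if l = b then (columnDiagram 2).transpose else ⊥
  pos :=
    { toFun := fun i => ⟨(b, 0, (i : ℕ)), by
        simpa [YoungDiagram.mem_transpose, mem_columnDiagram] using Nat.le_of_lt_succ i.2⟩
      invFun := fun p => ⟨p.1.2.2, by
        obtain ⟨⟨l, r, c⟩, hp⟩ := p
        by_cases hl : l = b
        · simp only [hl, if_true, YoungDiagram.mem_transpose, mem_columnDiagram] at hp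
          exact hp.1
        · simp [hl] at hp⟩
      left_inv := fun i => rfl
      right_inv := fun p => by
        obtain ⟨⟨l, r, c⟩, hp⟩ := p
        by_cases hl : l = b
        · subst hl
          simp only [if_true, YoungDiagram.mem_transpose, mem_columnDiagram] at hp
          have : r = 0 := hp.2
          simp [this]
        · simp [hl] at hp }
  standard := fun i j _ h => h.2

theorem zero_mem_contentSet (c : ℂ) : (0 : ℂ) ∈ (contentSet_finite ![0, c] 2).toFinset := by
  rw [Set.Finite.mem_toFinset]
  exact ⟨columnTableau 2 0, 0, by
    change (0 : ℂ) + ((0 : ℕ) : ℂ) - ((0 : ℕ) : ℂ) = _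
    simp⟩

/-- This content supplies the factor `x₂ - (c + 1)` of the idempotent, used to show that it vanishes
along with the gap. -/
theorem succ_mem_contentSet (c : ℂ) : c + 1 ∈ (contentSet_finite ![0, c] 2).toFinset := by
  rw [Set.Finite.mem_toFinset]
  exact ⟨rowTableau 1, 1, by
    change c + ((1 : ℕ) : ℂ) - ((0 : ℕ) : ℂ) = _
    simp⟩

/-- The interpolation polynomials are evaluated at the eigenvalues `k + 1` and `k` of the gap, where
both equal `1`. -/
theorem incl_signIdempotent_mul_gap (k : ℕ) (h : 2 ≤ n) :
    incl ![0, (k : ℂ) + 1] h (signIdempotent ![0, (k : ℂ) + 1] 2 1) * gap ![0, (k : ℂ) + 1] h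
      = gap ![0, (k : ℂ) + 1] h := by
  have h1 := x_one_mul_gap (c := (k : ℂ) + 1) h
  rw [add_sub_cancel_right] at h1
  rw [incl_signIdempotent, mul_assoc, aeval_mul_of_mul_eq_smul h1,
    mul_smul_comm, aeval_mul_of_mul_eq_smul (x_zero_mul_gap h), eval_interp, eval_interp, one_smul,
    one_smul]

/-- The idempotent is a polynomial multiple of `x₁ x₂ (x₂ - (k + 2))`, and this product vanishes
once the gap does. -/
theorem map_incl_signIdempotent {A : Type*} [Ring A] {k : ℕ} (hk : 0 < k) (h : 2 ≤ n)
    (f : Hecke ![0, (k : ℂ) + 1] n →+* A) (hf : f (gap _ h) = 0) :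
    f (incl ![0, (k : ℂ) + 1] h (signIdempotent ![0, (k : ℂ) + 1] 2 1)) = 0 := by
  have hk' : (k : ℂ) ≠ 0 := Nat.cast_ne_zero.2 hk.ne'
  have hk1 : (k : ℂ) + 1 ≠ 0 := by exact_mod_cast Nat.succ_ne_zero k
  have hk2 : (k : ℂ) + 1 + 1 ≠ 0 := by exact_mod_cast Nat.succ_ne_zero (k + 1)
  set S := (contentSet_finite ![0, (k : ℂ) + 1] 2).toFinset with hS
  have h0 : Polynomial.X ∣ interp S (k + 1) := by
    simpa using dvd_interp (b := 0) (zero_mem_contentSet _) hk1.symm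
  -- The roots `0` and `k + 2` are distinct contents, both different from `k`; positivity of `k` is
  -- needed for `0`.
  have h1 : Polynomial.X * (Polynomial.X - Polynomial.C ((k : ℂ) + 1 + 1)) ∣ interp S k := by
    have hcop : IsCoprime (Polynomial.X - Polynomial.C (0 : ℂ))
        (Polynomial.X - Polynomial.C ((k : ℂ) + 1 + 1)) :=
      Polynomial.isCoprime_X_sub_C_of_isUnit_sub (by simpa using hk2.isUnit.neg)
    have := hcop.mul_dvd (dvd_interp (b := 0) (zero_mem_contentSet _) hk'.symm)
      (dvd_interp (a := k) (succ_mem_contentSet _) (by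
        intro e
        have : (1 : ℂ) + 1 = 0 := by linear_combination e
        norm_num at this))
    simpa using this
  obtain ⟨q0, hq0⟩ := h0
  obtain ⟨q1, hq1⟩ := h1
  set x0 : Hecke ![0, (k : ℂ) + 1] n := x ⟨0, by omega⟩ with hx0
  set x1 : Hecke ![0, (k : ℂ) + 1] n := x ⟨1, h⟩ with hx1
  set s0 : Hecke ![0, (k : ℂ) + 1] n := s ⟨0, by omega⟩ with hs0
  have hc : f x0 * f x1 * f s0 = f x0 * f x1 := by
    simp only [gap, map_sub, map_mul, sub_eq_zero] at hf
    exact hf.symm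
  have hsucc : x1 = s0 * x0 * s0 + s0 := x_succ_eq 0 (by omega)
  have hsq : x0 * x0 = ((k : ℂ) + 1) • x0 := x_zero_sq _
  have hcomm : x0 * x1 = x1 * x0 := x_comm _ _
  -- Expand the last `x₂` as `s₁ x₁ s₁ + s₁`: after `x₁ x₂` each `s₁` is absorbed and `x₁` acts by
  -- `k + 1`, so `x₂` acts there by `k + 2`.
  have hmid : f (x0 * (x1 * (x1 - algebraMap ℂ _ ((k : ℂ) + 1 + 1)))) = 0 := by
    have e1 : f x0 * f x1 * f x1
        = f (x0 * x1 * x0 * s0 + x0 * x1) := by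
      nth_rewrite 2 [hsucc]
      rw [map_add, map_mul, map_mul, mul_add, ← mul_assoc, ← mul_assoc, hc, map_add, map_mul,
        map_mul, map_mul]
    have e2 : x0 * x1 * x0 * s0 = ((k : ℂ) + 1) • (x0 * x1 * s0) := by
      rw [hcomm, mul_assoc x1, hsq, mul_smul_comm, smul_mul_assoc]
    have e3 : f (((k : ℂ) + 1) • (x0 * x1 * s0)) = f (((k : ℂ) + 1) • (x0 * x1)) := by
      rw [Algebra.smul_def, Algebra.smul_def, map_mul, map_mul f (algebraMap _ _ _), map_mul,
        map_mul, hc]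
    have e4 : x0 * (x1 * (x1 - algebraMap ℂ _ ((k : ℂ) + 1 + 1)))
        = x0 * x1 * x1 - (((k : ℂ) + 1) • (x0 * x1) + x0 * x1) := by
      rw [mul_sub, mul_sub, ← mul_assoc, Algebra.algebraMap_eq_smul_one, mul_smul_comm,
        mul_smul_comm, mul_one, add_smul ((k : ℂ) + 1), one_smul]
    rw [e4, map_sub, map_mul, map_mul, e1, e2, map_add, e3, map_add, sub_self]
  rw [incl_signIdempotent, ← hS, hq0, hq1]
  rw [mul_comm Polynomial.X q0]
  simp only [map_mul, map_sub, Polynomial.aeval_X, Polynomial.aeval_C] at hmid ⊢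
  simp only [← hx0, ← hx1]
  rw [mul_assoc, ← mul_assoc (f x0), hmid, zero_mul, mul_zero]

/-- For `κ 0 = 0` the relation is `x s x s = x - x s + x s x`; substituting `x₂ = s x s + s` in the
gap gives the same four terms. -/
theorem quotRel_sub_eq_gap {a b : Hecke ![0, c] n} (hab : QuotRel ![0, c] n a b) :
    ∃ h : 2 ≤ n, a - b = gap ![0, c] h := by
  obtain ⟨h, _, _, rfl, rfl⟩ := hab
  refine ⟨h, ?_⟩
  have hsucc := x_succ_eq (κ := ![0, c]) (n := n) 0 (by omega)
  simp only [zero_add] at hsucc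
  have hs := s_mul_s (κ := ![0, c]) (n := n) ⟨0, by omega⟩
  rw [gap, hsucc]
  simp only [Matrix.cons_val_zero, zero_smul, add_zero, zero_add, one_smul, mul_add,
    add_mul, pow_two, mul_assoc, hs, mul_one]
  abel

end Hecke

namespace HeckeQuot

variable {n : ℕ} {c : ℂ}

theorem mk_surjective (κ : Fin 2 → ℂ) (n : ℕ) : Function.Surjective (mk κ n) :=
  RingQuot.mkAlgHom_surjective ℂ _

theorem mk_gap (h : 2 ≤ n) : mk ![0, c] n (Hecke.gap _ h) = 0 := by
  have hr := QuotRel.rel (κ := ![0, c]) h _ _ rfl rfl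
  obtain ⟨_, e⟩ := Hecke.quotRel_sub_eq_gap hr
  rw [← e, map_sub, sub_eq_zero]
  exact RingQuot.mkAlgHom_rel ℂ hr

end HeckeQuot

end

/-! ### The main theorem -/

noncomputable section

namespace FusedAlg

variable {k n : ℕ}

instance : Finite (FusedPerm k n) := Finite.of_surjective _ (fuse_surjective k n)

theorem phi_gap (hk : 0 < k) (h : 2 ≤ n) : phi k n hk (Hecke.gap _ h) = 0 := by
  rw [Hecke.gap, map_sub, phi_collapse hk h, sub_self]

/-- The morphism from the quotient algebra. -/
def psi (k n : ℕ) (hk : 0 < k) : HeckeQuot ![0, (k : ℂ) + 1] n →ₐ[ℂ] FusedAlg k n :=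
  RingQuot.liftAlgHom ℂ ⟨phi k n hk, by
    intro a b hab
    obtain ⟨h, e⟩ := Hecke.quotRel_sub_eq_gap hab
    rw [← sub_eq_zero, ← map_sub, e, phi_gap]⟩

theorem psi_mk (hk : 0 < k) (a : Hecke ![0, (k : ℂ) + 1] n) :
    psi k n hk (HeckeQuot.mk _ n a) = phi k n hk a :=
  RingQuot.liftAlgHom_mkAlgHom_apply ℂ _ _ _

theorem span_mk_sOf_eq_top (k n : ℕ) :
    Submodule.span ℂ (Set.range fun w : {w : SignedPerm n // SignedPerm.Avoids w} =>
      HeckeQuot.mk ![0, (k : ℂ) + 1] n (Hecke.sOf _ w.1)) = ⊤ :=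
  Hecke.span_sOf_eq_top (HeckeQuot.mk_surjective _ n) fun h => by
    have := HeckeQuot.mk_gap (c := (k : ℂ) + 1) (n := n) h
    rw [Hecke.gap, map_sub, sub_eq_zero] at this
    exact this.symm

theorem span_phi_sOf_eq_top (hk : 0 < k) :
    Submodule.span ℂ (Set.range fun w : {w : SignedPerm n // SignedPerm.Avoids w} =>
      phi k n hk (Hecke.sOf _ w.1)) = ⊤ :=
  Hecke.span_sOf_eq_top (phi_surjective hk) fun h => phi_collapse hk h

/-- The family spans and, by the injection into diagrams, its index set is no larger than the
dimension. -/
theorem linearIndependent_phi_sOf (hk : 0 < k) (hnk : n ≤ k) :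
    LinearIndependent ℂ fun w : {w : SignedPerm n // SignedPerm.Avoids w} =>
      phi k n hk (Hecke.sOf _ w.1) := by
  have := Fintype.ofFinite {w : SignedPerm n // SignedPerm.Avoids w}
  refine linearIndependent_of_top_le_span_of_card_le_finrank (span_phi_sOf_eq_top hk).ge ?_
  rw [Module.finrank_eq_nat_card_basis (diagramBasis k n), ← Nat.card_eq_fintype_card]
  exact Nat.card_le_card_of_injective (fun w => SignedPerm.toFusedPerm hnk w.1) fun w w' h =>
    Subtype.ext (SignedPerm.toFusedPerm_injOn hnk w.2 w'.2 h)

/-- A spanning family of the quotient has linearly independent images, so nothing is killed. -/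
theorem psi_bijective (hk : 0 < k) (hnk : n ≤ k) : Function.Bijective (psi k n hk) := by
  have hli := linearIndependent_phi_sOf hk hnk
  refine ⟨(injective_iff_map_eq_zero _).2 fun a ha => ?_, fun b => ?_⟩
  · have hmem : a ∈ Submodule.span ℂ (Set.range fun
        w : {w : SignedPerm n // SignedPerm.Avoids w} =>
          HeckeQuot.mk ![0, (k : ℂ) + 1] n (Hecke.sOf _ w.1)) := by
      rw [span_mk_sOf_eq_top]; trivial
    obtain ⟨c, rfl⟩ := Finsupp.mem_span_range_iff_exists_finsupp.1 hmem
    rw [map_finsuppSum] at ha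
    simp only [map_smul, psi_mk] at ha
    rw [linearIndependent_iff.1 hli c ha, Finsupp.sum_zero_index]
  · obtain ⟨a, rfl⟩ := phi_surjective hk b
    exact ⟨_, psi_mk hk a⟩

theorem ker_phi (hk : 0 < k) (hnk : n ≤ k) :
    TwoSidedIdeal.ker (phi k n hk) = TwoSidedIdeal.span
      {F | ∃ h : 2 ≤ n, F = Hecke.incl ![0, (k : ℂ) + 1] h
        (signIdempotent ![0, (k : ℂ) + 1] 2 1)} := by
  set S : Set (Hecke ![0, (k : ℂ) + 1] n) := {F | ∃ h : 2 ≤ n, F = Hecke.incl ![0, (k : ℂ) + 1] h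
    (signIdempotent ![0, (k : ℂ) + 1] 2 1)}
  refine le_antisymm (fun a ha => ?_) (TwoSidedIdeal.span_le.2 ?_)
  · let q : Hecke ![0, (k : ℂ) + 1] n →+* (TwoSidedIdeal.span S).ringCon.Quotient :=
      (TwoSidedIdeal.span S).ringCon.mk'
    have hker : ∀ b, q b = 0 ↔ b ∈ TwoSidedIdeal.span S := fun b => by
      rw [← TwoSidedIdeal.mem_ker, TwoSidedIdeal.ker_ringCon_mk']
    -- The gap is a multiple of the idempotent, so it dies modulo the ideal; the projection then
    -- factors through the quotient algebra, where the class of an element of the kernel is already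
    -- zero.
    have hq : ∀ h : 2 ≤ n, q (Hecke.gap _ h) = 0 := fun h => by
      rw [← Hecke.incl_signIdempotent_mul_gap k h, map_mul,
        (hker _).2 (TwoSidedIdeal.subset_span ⟨h, rfl⟩), zero_mul]
    let Q : HeckeQuot ![0, (k : ℂ) + 1] n →+* (TwoSidedIdeal.span S).ringCon.Quotient :=
      RingQuot.lift ⟨q, fun a b hab => by
        obtain ⟨h, e⟩ := Hecke.quotRel_sub_eq_gap hab
        rw [← sub_eq_zero, ← map_sub, e, hq]⟩
    have hQ : ∀ b, Q (HeckeQuot.mk _ n b) = q b := fun b => by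
      have : HeckeQuot.mk ![0, (k : ℂ) + 1] n b = RingQuot.mkRingHom (QuotRel _ n) b :=
        RingHom.congr_fun (RingQuot.mkAlgHom_coe ℂ _) b
      rw [this]
      exact RingQuot.lift_mkRingHom_apply _ _ _
    have hmk : HeckeQuot.mk ![0, (k : ℂ) + 1] n a = 0 :=
      (psi_bijective hk hnk).1 (by rw [psi_mk, map_zero]; exact (TwoSidedIdeal.mem_ker _).1 ha)
    rw [← hker, ← hQ, hmk, map_zero]
  · rintro _ ⟨h, rfl⟩
    exact (TwoSidedIdeal.mem_ker _).2
      (Hecke.map_incl_signIdempotent hk h (phi k n hk : _ →+* FusedAlg k n) (phi_gap hk h))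

end FusedAlg

end

theorem mainTheorem3 (n k : ℕ) (hk : 1 ≤ k) (hnk : n ≤ k) :
    ∃ phi : Hecke ![0, (k : ℂ) + 1] n →ₐ[ℂ] FusedAlg k n,
      (∀ i : Fin (n - 1), phi (Hecke.s i) = FusedAlg.sigma k n i) ∧
      (∀ hn : 0 < n, phi (Hecke.x ⟨0, hn⟩) = FusedAlg.t k n hk hn) ∧
      Function.Surjective phi ∧
      (∃ Psi : HeckeQuot ![0, (k : ℂ) + 1] n ≃ₐ[ℂ] FusedAlg k n,
        ∀ a, Psi (HeckeQuot.mk ![0, (k : ℂ) + 1] n a) = phi a) ∧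
      TwoSidedIdeal.ker phi = TwoSidedIdeal.span
        {F | ∃ h : 2 ≤ n, F = Hecke.incl ![0, (k : ℂ) + 1] h
          (signIdempotent ![0, (k : ℂ) + 1] 2 1)} ∧
      ∃ b : Module.Basis {w : SignedPerm n // SignedPerm.Avoids w} ℂ (FusedAlg k n),
        ∀ w, b w = phi (Hecke.sOf ![0, (k : ℂ) + 1] w.1) :=
  ⟨FusedAlg.phi k n hk, FusedAlg.phi_s_eq_sigma hk, FusedAlg.phi_x_zero hk,
    FusedAlg.phi_surjective hk,
    ⟨AlgEquiv.ofBijective (FusedAlg.psi k n hk) (FusedAlg.psi_bijective hk hnk),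
      FusedAlg.psi_mk hk⟩,
    FusedAlg.ker_phi hk hnk,
    Module.Basis.mk (FusedAlg.linearIndependent_phi_sOf hk hnk)
      (FusedAlg.span_phi_sOf_eq_top hk).ge,
    fun w => Module.Basis.mk_apply _ _ w⟩
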